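/- Let $\Sigma$ be a finite signed graph: a finite graph with node set $V$ and edge set $E$, in which multiple edges are allowed and each edge is a link or a loop (each with a sign $\sigma(e)\in\{+1,-1\}$), a halfedge (one end, no sign) or a loose edge (no end, no sign). A circle is a 2-regular connected subgraph consisting of links and loops. A subgraph is balanced if it has no halfedges and the product of the signs of the edges of each of its circles is $+1$. For $T\subseteq E$ let $b(T)$ be the number of balanced connected components of the spanning subgraph $(V,T)$, ignoring loose edges. The bias matroid $G(\Sigma)$ is the matroid on $E$ with rank function $r(T)=|V|-b(T)$. Its Tutte polynomial is $$t_{G(\Sigma)}(x,y)=\sum_{T\subseteq E}(x-1)^{r(E)-r(T)}(y-1)^{|T|-r(T)},$$ and $\xi(\Sigma)=|E|-|V|+b(E)$. An orientation of $\Sigma$ assigns to each edge end $\varepsilon$ a direction $\eta(\varepsilon)\in\{+1,-1\}$ ($+1$ if the arrow there points into the node, $-1$ if away from it) such that $\eta(\varepsilon_1)\eta(\varepsilon_2)=-\sigma(e)$ for each link or loop $e$ with ends $\varepsilon_1,\varepsilon_2$; a loose edge is taken to have two opposite orientations, as every other edge has. A cycle of an orientation is a circuit of $G(\Sigma)$ such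 that no node incident with it has all arrows of the circuit pointing into it or all pointing away from it. An orientation is totally cyclic if every edge belongs to a cycle. Let $\eta(v,e)$ be the sum of $\eta(\varepsilon)$ over the ends $\varepsilon$ of $e$ at $v$. For an abelian group $A$, a nowhere-zero $A$-flow is a function $x:E\to A\setminus\{0\}$ with $\sum_{e}\eta(v,e)\,x(e)=0$ for all $v\in V$. Then there is a unique polynomial $\bar\phi_\Sigma\in\mathbb Z[k]$ such that, for every finite abelian group $A$ of odd order and every orientation of $\Sigma$, the number of nowhere-zero $A$-flows is $\bar\phi_\Sigma(|A|)$; and the number of totally cyclic orientations of $\Sigma$ equals $$(-1)^{\xi(\Sigma)}\,\bar\phi_\Sigma(-1)=t_{G(\Sigma)}(0,2).$$ -/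

import Mathlib

/-- The shape of an edge in a signed graph with node set `V`.  An `ordinary` edge has two ends,
at the nodes `v` and `w`, and a sign: it is a link if `v ≠ w` and a loop if `v = w`.
A `half` edge has one end, a `loose` edge has none; neither has a sign.
The listing of the two ends of an ordinary edge as first and second only serves to tell
them apart. -/
inductive SignedEdge (V : Type*) where
  | ordinary (v w : V) (s : ℤˣ)
  | half (v : V)
  | loose

namespace SignedEdge

variable {V : Type*}

/-- The nodes at the ends of an edge, with multiplicity (a loop has both ends at one node). -/
def ends : SignedEdge V → Multiset V
  | ordinary v w _ => {v, w}
  | half v => {v}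
  | loose => 0

/-- Links and loops. -/
def IsOrdinary : SignedEdge V → Prop
  | ordinary _ _ _ => True
  | half _ => False
  | loose => False

/-- Halfedges. -/
def IsHalf : SignedEdge V → Prop
  | ordinary _ _ _ => False
  | half _ => True
  | loose => False

/-- The sign of a link or loop; the value `1` at the other edges is never used. -/
def sign : SignedEdge V → ℤˣ
  | ordinary _ _ s => s
  | half _ => 1
  | loose => 1

/-- An orientation of an edge.  Each end `ε` gets a direction `η(ε)`, which is `1` if the arrow
at that end points into its node and `-1` if it points away from it; a link or loop with ends
`ε₁`, `ε₂` must satisfy `η(ε₁) η(ε₂) = -σ`.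
A loose edge has no end; as every other edge does, it has two (opposite) orientations, which are
a formal `1` and `-1` here. -/
def Orientation : SignedEdge V → Type
  | ordinary _ _ s => {η : ℤˣ × ℤˣ // η.1 * η.2 = -s}
  | half _ => ℤˣ
  | loose => ℤˣ

/-- The ends of an oriented edge: the node at each end, with the direction of the arrow there. -/
def arrows : (d : SignedEdge V) → d.Orientation → Multiset (V × ℤˣ)
  | ordinary v w _, η => {(v, η.1.1), (w, η.1.2)}
  | half v, η => {(v, η)}
  | loose, _ => 0

end SignedEdge

/-- A signed graph with node set `V` and edge set `E`; multiple edges, loops, halfedges and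
loose edges are allowed. -/
structure SignedGraph (V E : Type*) where
  edge : E → SignedEdge V

namespace SignedGraph

variable {V E : Type*} (S : SignedGraph V E)

/-- The adjacency of distinct nodes in the spanning subgraph with edge set `T`, as a simple graph.
It has the same connected components as that subgraph. -/
def adjGraph (T : Finset E) : SimpleGraph V :=
  SimpleGraph.fromRel fun u v => ∃ e ∈ T, u ∈ (S.edge e).ends ∧ v ∈ (S.edge e).ends

open scoped Classical in
/-- The degree of a node in the spanning subgraph with edge set `T`; a loop counts twice. -/
noncomputable def degree (T : Finset E) (v : V) : ℕ :=
  ∑ e ∈ T, (S.edge e).ends.count v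

/-- A circle, given by its edge set: a nonempty 2-regular connected subgraph of links and loops. -/
def IsCircle (C : Finset E) : Prop :=
  C.Nonempty ∧ (∀ e ∈ C, (S.edge e).IsOrdinary) ∧
    (∀ v, S.degree C v = 0 ∨ S.degree C v = 2) ∧
    ∀ u v, S.degree C u ≠ 0 → S.degree C v ≠ 0 → (S.adjGraph C).Reachable u v

/-- An edge set is balanced if it has no halfedge and every circle in it has positive sign. -/
def IsBalanced (T : Finset E) : Prop :=
  (∀ e ∈ T, ¬ (S.edge e).IsHalf) ∧
    ∀ C ⊆ T, S.IsCircle C → ∏ e ∈ C, (S.edge e).sign = 1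

open scoped Classical in
/-- The edges of a connected component of the spanning subgraph with edge set `T`. -/
noncomputable def componentEdges (T : Finset E) (K : (S.adjGraph T).ConnectedComponent) :
    Finset E :=
  T.filter fun e => ∃ v ∈ (S.edge e).ends, v ∈ K.supp

/-- `b(Σ|T)`: the number of balanced connected components of the spanning subgraph with edge
set `T`, loose edges being ignored. -/
noncomputable def numBalanced (T : Finset E) : ℕ :=
  Nat.card {K : (S.adjGraph T).ConnectedComponent // S.IsBalanced (S.componentEdges T K)}

/-- The rank function `r(T) = |V| - b(Σ|T)` of the bias matroid `G(Σ)`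
(`b(Σ|T) ≤ |V|`, as each component contains a node). -/
noncomputable def rank [Fintype V] (T : Finset E) : ℕ :=
  Fintype.card V - S.numBalanced T

/-- The circuits of the bias matroid `G(Σ)`: its minimal dependent sets. -/
def IsCircuit [Fintype V] (C : Finset E) : Prop :=
  Minimal (fun T : Finset E => S.rank T < T.card) C

/-- The Tutte polynomial `∑_{T ⊆ E} (x - 1)^(r(E) - r(T)) (y - 1)^(|T| - r(T))` of the bias
matroid `G(Σ)`; the variable `x` is `X 0` and `y` is `X 1`. -/
noncomputable def tuttePolynomial [Fintype V] [Fintype E] : MvPolynomial (Fin 2) ℤ :=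
  ∑ T ∈ (Finset.univ : Finset E).powerset,
    (MvPolynomial.X 0 - 1) ^ (S.rank Finset.univ - S.rank T) *
      (MvPolynomial.X 1 - 1) ^ (T.card - S.rank T)

/-- The cyclomatic number `ξ(Σ) = |E| - |V| + b(Σ)`. -/
noncomputable def cyclomatic [Fintype V] [Fintype E] : ℤ :=
  (Fintype.card E : ℤ) - Fintype.card V + S.numBalanced Finset.univ

/-- An orientation of a signed graph (that is, a bidirection that induces its signs). -/
def Orientation : Type _ := ∀ e, (S.edge e).Orientation

variable {S}

/-- A cycle of an oriented signed graph: a circuit such that, at no node of it, all arrows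
of the circuit point into the node or all point away from it. -/
def Orientation.IsCycle [Fintype V] (τ : S.Orientation) (C : Finset E) : Prop :=
  S.IsCircuit C ∧ ∀ v, (∃ e ∈ C, v ∈ (S.edge e).ends) →
    (∃ e ∈ C, (v, (1 : ℤˣ)) ∈ (S.edge e).arrows (τ e)) ∧
    (∃ e ∈ C, (v, (-1 : ℤˣ)) ∈ (S.edge e).arrows (τ e))

/-- An orientation is totally cyclic if every edge belongs to a cycle. -/
def Orientation.IsTotallyCyclic [Fintype V] (τ : S.Orientation) : Prop :=
  ∀ e, ∃ C, τ.IsCycle C ∧ e ∈ C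

open scoped Classical in
/-- The entry `η(v, e)` of the bidirected incidence matrix: the sum of `η(ε)` over the ends `ε`
of `e` at `v`. -/
noncomputable def Orientation.incidence (τ : S.Orientation) (v : V) (e : E) : ℤ :=
  ((((S.edge e).arrows (τ e)).filter fun p => p.1 = v).map fun p => (p.2 : ℤ)).sum

/-- A flow with values in an abelian group. -/
def Orientation.IsFlow [Fintype E] (τ : S.Orientation) {A : Type*} [AddCommGroup A]
    (x : E → A) : Prop :=
  ∀ v, ∑ e, τ.incidence v e • x e = 0

variable (S)

/-- `φ` is the (strict) modular flow polynomial of the signed graph: for each finite abelian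
group `A` of odd order, `φ(|A|)` is the number of nowhere-zero flows with values in `A`,
whatever the orientation with respect to which flows are expressed. -/
def IsModularFlowPolynomial [Fintype E] (φ : Polynomial ℤ) : Prop :=
  ∀ (A : Type) [AddCommGroup A] [Finite A], Odd (Nat.card A) → ∀ τ : S.Orientation,
    (Nat.card {x : E → A // τ.IsFlow x ∧ ∀ e, x e ≠ 0} : ℤ) = φ.eval (Nat.card A : ℤ)

end SignedGraph

/-!
The rank `r(T) = |V| - b(T)` of the bias matroid governs flows with values in every group `A` in
which division by two is possible, real flows included.  By Harary's theorem
(`IsBalanced.exists_isSwitching`) a balanced component carries a switching function, and the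
image of the boundary map `A ^ T → A ^ V` is cut out by one switched sum for each balanced
component (`range_boundary`).  The inclusion which is not evident holds because the classes of
`a` placed at the single nodes form, modulo the image, a potential with values in a group without
two-torsion.  A potential vanishes on unbalanced components and is constant, up to switching,
on balanced ones.  Hence the flows supported in `T` number `|A| ^ (|T| - r(T))` if `A` is finite
of odd order (`card_flows`), and form a space of dimension `|T| - r(T)` over `ℝ`
(`finrank_flows`).

Inclusion and exclusion turns the first count into the polynomial
`∑ T, (-1) ^ |E \ T| k ^ (|T| - r(T))`, whose value at `-1` is, up to the sign `(-1) ^ ξ`, the sum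
`∑ T, (-1) ^ (r(E) - r(T))`, which is the value of the Tutte polynomial at `(0, 2)`.

The same sum counts totally cyclic orientations.  An orientation is totally cyclic if and only if
it has a real flow that is positive on every edge (`Orientation.isTotallyCyclic_iff`).  One
direction decomposes a positive flow into flows of minimal support.  The other finds a
nonnegative flow on each cycle by a separation argument.  So totally cyclic orientations
correspond to the regions into which the coordinate hyperplanes cut the space of real flows of
one fixed orientation, and Zaslavsky's theorem (`card_signPatterns`) counts these regions by the
dimensions of the spaces of flows supported in `T`.
-/

/-! ### Switching functions and balance -/

namespace SignedGraph

section Balance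

variable {V E : Type*} (S : SignedGraph V E)

/-- A switching function for the edge set `T`: a labelling of the nodes by signs such that the
sign of each link or loop in `T` is the product of the labels of its ends. -/
def IsSwitching (T : Finset E) (s : V → ℤˣ) : Prop :=
  ∀ e ∈ T, ∀ v w σ, S.edge e = .ordinary v w σ → s v * s w = σ

variable {S}

theorem adjGraph_reachable {T : Finset E} {e : E} (he : e ∈ T) {v w : V} {σ : ℤˣ}
    (h : S.edge e = .ordinary v w σ) : (S.adjGraph T).Reachable v w := by
  by_cases hvw : v = w
  · subst hvw; rfl
  · refine SimpleGraph.Adj.reachable ?_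
    rw [adjGraph, SimpleGraph.fromRel_adj]
    exact ⟨hvw, Or.inl ⟨e, he, by simp [h, SignedEdge.ends], by simp [h, SignedEdge.ends]⟩⟩

theorem exists_ordinary_of_adj {T : Finset E} {v w : V} (h : (S.adjGraph T).Adj v w) :
    ∃ e ∈ T, (S.edge e).IsOrdinary ∧ (S.edge e).ends = {v, w} := by
  rw [adjGraph, SimpleGraph.fromRel_adj] at h
  obtain ⟨hvw, h⟩ := h
  have key : ∀ e, v ∈ (S.edge e).ends → w ∈ (S.edge e).ends →
      (S.edge e).IsOrdinary ∧ (S.edge e).ends = {v, w} := by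
    intro e h1 h2
    cases h : S.edge e with
    | ordinary a b σ =>
      simp only [h, SignedEdge.ends, Multiset.insert_eq_cons, Multiset.mem_cons,
        Multiset.mem_singleton] at h1 h2 ⊢
      refine ⟨trivial, ?_⟩
      rcases h1 with rfl | rfl <;> rcases h2 with rfl | rfl
      · exact absurd rfl hvw
      · rfl
      · exact Multiset.pair_comm _ _
      · exact absurd rfl hvw
    | half a =>
      simp only [h, SignedEdge.ends, Multiset.mem_singleton] at h1 h2
      exact absurd (h1.trans h2.symm) hvw
    | loose => simp [h, SignedEdge.ends] at h1
  rcases h with ⟨e, he, h1, h2⟩ | ⟨e, he, h1, h2⟩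
  · exact ⟨e, he, key e h1 h2⟩
  · exact ⟨e, he, key e h2 h1⟩

theorem adjGraph_mono {T T' : Finset E} (h : T ⊆ T') : S.adjGraph T ≤ S.adjGraph T' := by
  intro v w hvw
  rw [adjGraph, SimpleGraph.fromRel_adj] at hvw ⊢
  exact ⟨hvw.1, hvw.2.imp (fun ⟨e, he, h'⟩ => ⟨e, h he, h'⟩) fun ⟨e, he, h'⟩ => ⟨e, h he, h'⟩⟩

theorem degree_insert [DecidableEq V] [DecidableEq E] {T : Finset E} {e : E} (he : e ∉ T) (v : V) :
    S.degree (insert e T) v = (S.edge e).ends.count v + S.degree T v := by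
  unfold degree
  rw [Finset.sum_insert he]
  congr!

theorem degree_ne_zero {T : Finset E} {e : E} (he : e ∈ T) {v : V} (hv : v ∈ (S.edge e).ends) :
    S.degree T v ≠ 0 := by
  classical
  intro h
  have := (Finset.sum_eq_zero_iff.1 h) e he
  exact (Multiset.count_eq_zero.1 this) hv

open scoped Classical in
/-- A path in the spanning subgraph is traced by a set of links, in which its inner nodes have
degree two and its two end nodes degree one. -/
theorem exists_edges_of_path {T : Finset E} {v w : V} (p : (S.adjGraph T).Walk v w)
    (hp : p.IsPath) :
    ∃ D ⊆ T, (∀ e ∈ D, (S.edge e).IsOrdinary) ∧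
      (∀ u, S.degree D u + ((if u = v then 1 else 0) + (if u = w then 1 else 0)) =
        if u ∈ p.support then 2 else 0) ∧
      ∀ u ∈ p.support, (S.adjGraph D).Reachable v u := by
  induction p with
  | nil =>
    refine ⟨∅, by simp, by simp, fun u => ?_, fun u hu => ?_⟩
    · simp only [degree, Finset.sum_empty, SimpleGraph.Walk.support_nil, List.mem_singleton]
      split_ifs <;> rfl
    · simp only [SimpleGraph.Walk.support_nil, List.mem_singleton] at hu
      subst hu; rfl
  | @cons v v' w h p ih =>
    rw [SimpleGraph.Walk.cons_isPath_iff] at hp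
    obtain ⟨D, hDT, hord, hdeg, hreach⟩ := ih hp.1
    obtain ⟨e, heT, heo, hends⟩ := exists_ordinary_of_adj h
    have hvw : v ≠ w := by rintro rfl; exact hp.2 p.end_mem_support
    have hdv : S.degree D v = 0 := by
      have := hdeg v
      rw [if_neg hp.2] at this
      omega
    have heD : e ∉ D := fun he => degree_ne_zero he (v := v) (by simp [hends]) hdv
    have hadj : (S.adjGraph (insert e D)).Reachable v v' := by
      refine SimpleGraph.Adj.reachable ?_
      rw [adjGraph, SimpleGraph.fromRel_adj]
      exact ⟨h.ne, Or.inl ⟨e, by simp, by simp [hends], by simp [hends]⟩⟩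
    refine ⟨insert e D, Finset.insert_subset heT hDT, ?_, fun u => ?_, fun u hu => ?_⟩
    · intro f hf
      rcases Finset.mem_insert.1 hf with rfl | hf
      exacts [heo, hord f hf]
    · rw [degree_insert heD, hends]
      have := hdeg u
      simp only [SimpleGraph.Walk.support_cons, List.mem_cons, Multiset.insert_eq_cons,
        Multiset.count_cons, Multiset.count_singleton]
      by_cases huv : u = v
      · subst huv
        simp only [hp.2, or_false, if_true, if_neg h.ne, if_neg hvw] at this ⊢
        omega
      · simp only [huv, if_false, false_or] at this ⊢
        omega
    · simp only [SimpleGraph.Walk.support_cons, List.mem_cons] at hu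
      rcases hu with rfl | hu
      · rfl
      · exact hadj.trans ((hreach u hu).mono (adjGraph_mono (Finset.subset_insert _ _)))

/-- A link or loop whose ends are joined by a path in `T` closes up a circle. -/
theorem exists_isCircle_insert [DecidableEq E] {T : Finset E} {e : E} (he : e ∉ T) {v w : V}
    {σ : ℤˣ} (h : S.edge e = .ordinary v w σ) (hr : (S.adjGraph T).Reachable v w) :
    ∃ D ⊆ T, S.IsCircle (insert e D) := by
  classical
  obtain ⟨p, hp⟩ := hr.exists_isPath
  obtain ⟨D, hDT, hord, hdeg, hreach⟩ := exists_edges_of_path p hp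
  have hd : ∀ u, S.degree (insert e D) u = if u ∈ p.support then 2 else 0 := by
    intro u
    rw [degree_insert (fun h' => he (hDT h')), ← hdeg u, h]
    simp only [SignedEdge.ends, Multiset.insert_eq_cons, Multiset.count_cons,
        Multiset.count_singleton]
    omega
  refine ⟨D, hDT, ⟨e, by simp⟩, ?_, fun u => ?_, fun u u' hu hu' => ?_⟩
  · intro f hf
    rcases Finset.mem_insert.1 hf with rfl | hf
    · rw [h]; trivial
    · exact hord f hf
  · rw [hd]; split_ifs <;> simp
  · have hs : ∀ u, S.degree (insert e D) u ≠ 0 → (S.adjGraph (insert e D)).Reachable v u := by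
      intro u hu
      rw [hd] at hu
      exact (hreach u (by by_contra hc; simp [hc] at hu)).mono
        (adjGraph_mono (Finset.subset_insert _ _))
    exact (hs u hu).symm.trans (hs u' hu')

theorem prod_ends_eq_one_of_isCircle [Fintype V] {C : Finset E} (hC : S.IsCircle C) (s : V → ℤˣ) :
    ∏ e ∈ C, ((S.edge e).ends.map s).prod = 1 := by
  classical
  have h1 : ∀ m : Multiset V, (m.map s).prod = ∏ v, s v ^ m.count v := by
    intro m
    rw [Finset.prod_multiset_map_count]
    refine Finset.prod_subset (Finset.subset_univ _) fun v _ hv => ?_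
    rw [Multiset.count_eq_zero.2 (by simpa using hv), pow_zero]
  simp_rw [h1]
  rw [Finset.prod_comm]
  refine Finset.prod_eq_one fun v _ => ?_
  rw [Finset.prod_pow_eq_pow_sum]
  have : ∑ e ∈ C, (S.edge e).ends.count v = S.degree C v := by
    unfold degree; congr!
  rw [this]
  rcases hC.2.2.1 v with h | h <;> rw [h] <;> simp

theorem IsSwitching.sign_eq {T : Finset E} {s : V → ℤˣ} (hs : S.IsSwitching T s) {e : E}
    (he : e ∈ T) (ho : (S.edge e).IsOrdinary) :
    (S.edge e).sign = ((S.edge e).ends.map s).prod := by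
  cases h : S.edge e with
  | ordinary v w σ => simp [SignedEdge.sign, SignedEdge.ends, hs e he v w σ h]
  | half v => simp [h, SignedEdge.IsOrdinary] at ho
  | loose => simp [h, SignedEdge.IsOrdinary] at ho

theorem IsSwitching.isBalanced [Fintype V] {T : Finset E} {s : V → ℤˣ} (hs : S.IsSwitching T s)
    (hh : ∀ e ∈ T, ¬ (S.edge e).IsHalf) : S.IsBalanced T := by
  refine ⟨hh, fun C hC hc => ?_⟩
  rw [Finset.prod_congr rfl fun e he => hs.sign_eq (hC he) (hc.2.1 e he)]
  exact prod_ends_eq_one_of_isCircle hc s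

/-- Harary's theorem: a balanced edge set has a switching function.  An edge that is joined to
the preceding ones without closing a circle is accommodated by negating the labels on one side;
an edge closing a circle fits already, as the circle is positive. -/
theorem IsBalanced.exists_isSwitching [Fintype V] {T : Finset E} (hT : S.IsBalanced T) :
    ∃ s, S.IsSwitching T s := by
  classical
  induction T using Finset.induction_on with
  | empty => exact ⟨1, by simp [IsSwitching]⟩
  | insert e T he ih =>
    obtain ⟨s, hs⟩ := ih ⟨fun f hf => hT.1 f (Finset.mem_insert_of_mem hf),
      fun C hC => hT.2 C (hC.trans (Finset.subset_insert _ _))⟩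
    by_cases hgood : ∀ v w σ, S.edge e = .ordinary v w σ → s v * s w = σ
    · refine ⟨s, fun f hf => ?_⟩
      rcases Finset.mem_insert.1 hf with rfl | hf
      exacts [hgood, hs f hf]
    push Not at hgood
    obtain ⟨v, w, σ, hedge, hne⟩ := hgood
    have hneg : s v * s w = -σ := by
      rcases Int.units_eq_one_or (s v * s w) with h | h <;>
        rcases Int.units_eq_one_or σ with h' | h' <;> simp_all
    by_cases hr : (S.adjGraph T).Reachable v w
    · exfalso
      obtain ⟨D, hDT, hD⟩ := exists_isCircle_insert he hedge hr
      have heD : e ∉ D := fun h => he (hDT h)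
      have h1 := hT.2 _ (Finset.insert_subset_insert e hDT) hD
      have h2 := prod_ends_eq_one_of_isCircle hD s
      rw [Finset.prod_insert heD] at h1 h2
      rw [Finset.prod_congr rfl fun f hf =>
        hs.sign_eq (hDT hf) (hD.2.1 f (Finset.mem_insert_of_mem hf))] at h1
      have h3 := mul_right_cancel (h1.trans h2.symm)
      rw [hedge] at h3
      simp [SignedEdge.sign, SignedEdge.ends] at h3
      exact hne h3.symm
    · -- the ends of `e` lie in different components, one of which is switched
      refine ⟨fun u => if (S.adjGraph T).Reachable v u then -s u else s u, ?_⟩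
      intro f hf a b ρ hab
      rcases Finset.mem_insert.1 hf with rfl | hf
      · rw [hedge] at hab
        cases hab
        simp [hr, hneg]
      · have hreach := adjGraph_reachable hf hab
        have hiff : (S.adjGraph T).Reachable v a ↔ (S.adjGraph T).Reachable v b :=
          ⟨fun h => h.trans hreach, fun h => h.trans hreach.symm⟩
        have := hs f hf a b ρ hab
        simp only [hiff]
        split_ifs <;> simp [this]

end Balance

end SignedGraph

/-! ### The image of the boundary map -/

theorem SignedEdge.eq_cases {V : Type*} (d : SignedEdge V) :
    (∃ v w σ, d = .ordinary v w σ) ∨ (∃ v, d = .half v) ∨ d = .loose := by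
  cases d <;> simp

namespace SignedGraph

section Boundary

variable {V E : Type*} {S : SignedGraph V E}

theorem Orientation.ordinary_mul (τ : S.Orientation) {e : E} {v w : V} {σ : ℤˣ}
    (h : S.edge e = .ordinary v w σ) :
    ∃ α β : ℤˣ, α * β = -σ ∧ (S.edge e).arrows (τ e) = {(v, α), (w, β)} := by
  generalize τ e = o
  revert o
  rw [h]
  rintro ⟨⟨α, β⟩, ho⟩
  exact ⟨α, β, ho, rfl⟩

theorem Orientation.half_arrows (τ : S.Orientation) {e : E} {v : V}
    (h : S.edge e = .half v) :
    ∃ α : ℤˣ, (S.edge e).arrows (τ e) = {(v, α)} := by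
  generalize τ e = o
  revert o
  rw [h]
  exact fun α => ⟨α, rfl⟩

theorem Orientation.loose_arrows (τ : S.Orientation) {e : E}
    (h : S.edge e = .loose) : (S.edge e).arrows (τ e) = 0 := by
  generalize τ e = o
  revert o
  rw [h]
  exact fun α => rfl

/-- The column of the incidence matrix at `e`, scaled by `a`, is the sum over the arrows of `e`. -/
theorem Orientation.incidence_smul [DecidableEq V] (τ : S.Orientation) {A : Type*} [AddCommGroup A]
    (e : E) (a : A) :
    (fun v => τ.incidence v e • a) =
      (((S.edge e).arrows (τ e)).map fun p => (Pi.single p.1 ((p.2 : ℤ) • a) : V → A)).sum := by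
  unfold Orientation.incidence
  induction (S.edge e).arrows (τ e) using Multiset.induction_on with
  | empty => ext; simp
  | cons p m ih =>
    rw [Multiset.map_cons, Multiset.sum_cons, ← ih]
    ext v
    by_cases h : p.1 = v
    · subst h
      simp [add_smul]
    · simp [Multiset.filter_cons_of_neg, h, Ne.symm h]

variable (R A : Type*) [CommRing R] [AddCommGroup A] [Module R A]

/-- The boundary map of an edge set: it sends `x : T → A` to its net inflow at the nodes. -/
noncomputable def Orientation.boundary (τ : S.Orientation) (T : Finset E) :
    (T → A) →ₗ[R] (V → A) where
  toFun x := fun v => ∑ e, τ.incidence v e.1 • x e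
  map_add' x y := by ext v; simp [Finset.sum_add_distrib]
  map_smul' r x := by
    ext v
    simp only [Pi.smul_apply, RingHom.id_apply, Finset.smul_sum]
    exact Finset.sum_congr rfl fun e _ => smul_comm _ _ _

variable {R A}

theorem Orientation.boundary_apply (τ : S.Orientation) (T : Finset E) (x : T → A) :
    τ.boundary R A T x = ∑ e : T, fun v => τ.incidence v e.1 • x e := by
  ext v; simp [boundary]

theorem mem_componentEdges_iff {T : Finset E} {e : E} {K : (S.adjGraph T).ConnectedComponent} :
    e ∈ S.componentEdges T K ↔
      e ∈ T ∧ ∃ v ∈ (S.edge e).ends, (S.adjGraph T).connectedComponentMk v = K := by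
  classical
  rw [componentEdges, Finset.mem_filter]
  rfl

theorem connectedComponentMk_eq_of_mem_componentEdges {T : Finset E} {e : E} (he : e ∈ T)
    {K : (S.adjGraph T).ConnectedComponent} {v w : V} {σ : ℤˣ}
    (h : S.edge e = .ordinary v w σ) (heK : e ∈ S.componentEdges T K) :
    (S.adjGraph T).connectedComponentMk v = K ∧ (S.adjGraph T).connectedComponentMk w = K := by
  classical
  have h1 := SimpleGraph.ConnectedComponent.sound (adjGraph_reachable he h)
  obtain ⟨-, u, hu, huK⟩ := mem_componentEdges_iff.1 heK
  simp only [h, SignedEdge.ends, Multiset.insert_eq_cons, Multiset.mem_cons,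
    Multiset.mem_singleton] at hu
  rcases hu with rfl | rfl
  · exact ⟨huK, h1.symm.trans huK⟩
  · exact ⟨h1.trans huK, huK⟩

theorem mem_componentEdges {T : Finset E} {e : E} (he : e ∈ T) {v : V}
    (h : v ∈ (S.edge e).ends) :
    e ∈ S.componentEdges T ((S.adjGraph T).connectedComponentMk v) :=
  mem_componentEdges_iff.2 ⟨he, v, h, rfl⟩

theorem not_isHalf_of_isBalanced {T : Finset E} {e : E} (he : e ∈ T) {v : V}
    (h : S.IsBalanced (S.componentEdges T ((S.adjGraph T).connectedComponentMk v))) :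
    S.edge e ≠ .half v := by
  intro hv
  refine h.1 e (mem_componentEdges he (by simp [hv, SignedEdge.ends])) ?_
  rw [hv]; trivial

/-- One labelling of the nodes that is a switching function on every balanced component. -/
theorem exists_switching [Fintype V] (S : SignedGraph V E) (T : Finset E) :
    ∃ s : V → ℤˣ, ∀ e ∈ T, ∀ v w σ, S.edge e = .ordinary v w σ →
      S.IsBalanced (S.componentEdges T ((S.adjGraph T).connectedComponentMk v)) →
      s v * s w = σ := by
  classical
  have : ∀ K : (S.adjGraph T).ConnectedComponent, ∃ s : V → ℤˣ,
      S.IsBalanced (S.componentEdges T K) → S.IsSwitching (S.componentEdges T K) s := by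
    intro K
    by_cases h : S.IsBalanced (S.componentEdges T K)
    · exact ⟨_, fun _ => h.exists_isSwitching.choose_spec⟩
    · exact ⟨1, fun h' => absurd h' h⟩
  choose s hs using this
  refine ⟨fun v => s ((S.adjGraph T).connectedComponentMk v) v, fun e he v w σ h hb => ?_⟩
  have h1 := SimpleGraph.ConnectedComponent.sound (adjGraph_reachable he h)
  simp only [← h1]
  exact hs _ hb e (mem_componentEdges he (by simp [h, SignedEdge.ends])) v w σ h

/-- Labels of the nodes in `B` that every column of the incidence matrix at `T` annihilates. -/
def Orientation.IsPotential (τ : S.Orientation) (T : Finset E) {B : Type*} [AddCommGroup B]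
    (q : V → B) : Prop :=
  ∀ e ∈ T, (((S.edge e).arrows (τ e)).map fun p => (p.2 : ℤ) • q p.1).sum = 0

section Potential

variable {B : Type*} [AddCommGroup B] {τ : S.Orientation} {T : Finset E} {q : V → B}

theorem Orientation.IsPotential.ordinary (hq : τ.IsPotential T q) {e : E} (he : e ∈ T) {v w : V}
    {σ : ℤˣ} (h : S.edge e = .ordinary v w σ) : q v = (σ : ℤ) • q w := by
  obtain ⟨α, β, hαβ, harr⟩ := τ.ordinary_mul h
  have := hq e he
  rw [harr] at this
  simp only [Multiset.insert_eq_cons, Multiset.map_cons, Multiset.map_singleton,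
    Multiset.sum_cons, Multiset.sum_singleton] at this
  rw [show σ = -(α * β) by rw [hαβ, neg_neg]]
  rcases Int.units_eq_one_or α with rfl | rfl <;> rcases Int.units_eq_one_or β with rfl | rfl <;>
    simp at this ⊢
  · exact eq_neg_of_add_eq_zero_left this
  · exact add_neg_eq_zero.1 this
  · exact neg_add_eq_zero.1 this
  · exact neg_eq_iff_eq_neg.1 (add_neg_eq_zero.1 this)

theorem Orientation.IsPotential.half (hq : τ.IsPotential T q) {e : E} (he : e ∈ T) {v : V}
    (h : S.edge e = .half v) : q v = 0 := by
  obtain ⟨α, harr⟩ := τ.half_arrows h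
  have := hq e he
  rw [harr] at this
  rcases Int.units_eq_one_or α with rfl | rfl <;> simpa using this

theorem Orientation.IsPotential.exists_sign (hq : τ.IsPotential T q) {u v : V}
    (h : (S.adjGraph T).Reachable u v) : ∃ σ : ℤˣ, q v = (σ : ℤ) • q u := by
  obtain ⟨p⟩ := h
  induction p with
  | nil => exact ⟨1, by simp⟩
  | cons hadj p ih =>
    rename_i a b c
    obtain ⟨σ, hσ⟩ := ih
    have : ∃ ρ : ℤˣ, q b = (ρ : ℤ) • q a := by
      obtain ⟨e, he, ho, hends⟩ := exists_ordinary_of_adj hadj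
      cases h : S.edge e with
      | ordinary x y ρ =>
        have hxy := hq.ordinary he h
        rw [h] at hends
        have hyx : q y = (ρ : ℤ) • q x := by
          rw [hxy, smul_smul, ← Units.val_mul, Int.units_mul_self, Units.val_one, one_smul]
        simp only [SignedEdge.ends] at hends
        rw [Multiset.insert_eq_cons, Multiset.insert_eq_cons, Multiset.cons_eq_cons] at hends
        rcases hends with ⟨rfl, h2⟩ | ⟨-, cs, h1, h2⟩
        · rw [Multiset.singleton_inj] at h2
          subst h2
          exact ⟨ρ, hyx⟩
        · rw [Multiset.singleton_eq_cons_iff] at h1 h2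
          obtain ⟨rfl, -⟩ := h1
          obtain ⟨rfl, -⟩ := h2
          exact ⟨ρ, hxy⟩
      | half x => rw [h] at ho; exact ho.elim
      | loose => rw [h] at ho; exact ho.elim
    obtain ⟨ρ, hρ⟩ := this
    exact ⟨σ * ρ, by rw [hσ, hρ, smul_smul, Units.val_mul]⟩

/-- Without two-torsion, a potential lives on balanced components only: the signs by which its
values in the component of `v` differ from `q v ≠ 0` are unique and form a switching function. -/
theorem Orientation.IsPotential.isBalanced [Fintype V] (hB : ∀ b : B, b + b = 0 → b = 0)
    (hq : τ.IsPotential T q) {v : V} (hv : q v ≠ 0) :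
    S.IsBalanced (S.componentEdges T ((S.adjGraph T).connectedComponentMk v)) := by
  classical
  have h1 : ∀ u, ∃ σ : ℤˣ, (S.adjGraph T).connectedComponentMk u =
      (S.adjGraph T).connectedComponentMk v → q u = (σ : ℤ) • q v := by
    intro u
    by_cases h : (S.adjGraph T).connectedComponentMk u = (S.adjGraph T).connectedComponentMk v
    · obtain ⟨σ, hσ⟩ := hq.exists_sign (SimpleGraph.ConnectedComponent.exact h.symm)
      exact ⟨σ, fun _ => hσ⟩
    · exact ⟨1, fun h' => absurd h' h⟩
  choose s hs using h1
  have huniq : ∀ α β : ℤˣ, (α : ℤ) • q v = (β : ℤ) • q v → α = β := by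
    intro α β h
    have hne : q v ≠ -q v := fun h => hv (hB _ (eq_neg_iff_add_eq_zero.1 h))
    rcases Int.units_eq_one_or α with rfl | rfl <;> rcases Int.units_eq_one_or β with rfl | rfl <;>
      simp at h ⊢
    exacts [hne h, hne h.symm]
  have hsw : S.IsSwitching (S.componentEdges T ((S.adjGraph T).connectedComponentMk v)) s := by
    intro e he a b σ h
    have heT : e ∈ T := (mem_componentEdges_iff.1 he).1
    obtain ⟨ha, hb⟩ := connectedComponentMk_eq_of_mem_componentEdges heT h he
    have h2 := hq.ordinary heT h
    rw [hs a ha, hs b hb, smul_smul, ← Units.val_mul] at h2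
    rw [huniq _ _ h2, mul_assoc, Int.units_mul_self, mul_one]
  refine hsw.isBalanced fun e he => ?_
  have heT : e ∈ T := (mem_componentEdges_iff.1 he).1
  cases h : S.edge e with
  | ordinary a b σ => exact fun h => h
  | half a =>
    intro _
    have ha : (S.adjGraph T).connectedComponentMk a = (S.adjGraph T).connectedComponentMk v := by
      obtain ⟨-, u, hu, huK⟩ := mem_componentEdges_iff.1 he
      simp only [h, SignedEdge.ends, Multiset.mem_singleton] at hu
      subst hu
      exact huK
    have h0 := hq.half heT h
    rw [hs a ha] at h0
    rcases Int.units_eq_one_or (s a) with h' | h' <;> simp [h'] at h0 <;> exact hv h0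
  | loose => exact fun h => h

/-- On a balanced component a potential is constant up to switching. -/
theorem Orientation.IsPotential.smul_eq (hq : τ.IsPotential T q) {s : V → ℤˣ}
    (hs : ∀ e ∈ T, ∀ v w σ, S.edge e = .ordinary v w σ →
      S.IsBalanced (S.componentEdges T ((S.adjGraph T).connectedComponentMk v)) →
      s v * s w = σ) {u v : V} (huv : (S.adjGraph T).Reachable u v)
    (hb : S.IsBalanced (S.componentEdges T ((S.adjGraph T).connectedComponentMk u))) :
    (s u : ℤ) • q u = (s v : ℤ) • q v := by
  obtain ⟨p⟩ := huv
  induction p with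
  | nil => rfl
  | cons hadj p ih =>
    rename_i a b c
    have hab := SimpleGraph.ConnectedComponent.sound hadj.reachable
    rw [← ih (hab ▸ hb)]
    obtain ⟨e, he, ho, hends⟩ := exists_ordinary_of_adj hadj
    have key : ∀ x y ρ, S.edge e = .ordinary x y ρ →
        S.IsBalanced (S.componentEdges T ((S.adjGraph T).connectedComponentMk x)) →
        (s x : ℤ) • q x = (s y : ℤ) • q y := by
      intro x y ρ h hb
      rw [hq.ordinary he h, ← hs e he x y ρ h hb, smul_smul, ← Units.val_mul, ← mul_assoc,
        Int.units_mul_self, one_mul]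
    cases h : S.edge e with
    | ordinary x y ρ =>
      rw [h] at hends
      simp only [SignedEdge.ends] at hends
      rw [Multiset.insert_eq_cons, Multiset.insert_eq_cons, Multiset.cons_eq_cons] at hends
      rcases hends with ⟨rfl, h2⟩ | ⟨-, cs, h1, h2⟩
      · rw [Multiset.singleton_inj] at h2
        subst h2
        exact key _ _ _ h hb
      · rw [Multiset.singleton_eq_cons_iff] at h1 h2
        obtain ⟨rfl, -⟩ := h1
        obtain ⟨rfl, -⟩ := h2
        exact (key _ _ _ h (hab ▸ hb)).symm
    | half x => rw [h] at ho; exact ho.elim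
    | loose => rw [h] at ho; exact ho.elim

end Potential

/-- The balanced components of the spanning subgraph with edge set `T`. -/
abbrev BalancedComponent (S : SignedGraph V E) (T : Finset E) : Type _ :=
  {K : (S.adjGraph T).ConnectedComponent // S.IsBalanced (S.componentEdges T K)}

open scoped Classical in
/-- The map that adds up, over each balanced component, the node labels switched by `s`. -/
noncomputable def componentSum [Fintype V] (R A : Type*) [CommRing R] [AddCommGroup A] [Module R A]
    (S : SignedGraph V E) (T : Finset E) (s : V → ℤˣ) :
    (V → A) →ₗ[R] (S.BalancedComponent T → A) where
  toFun z := fun K =>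
    ∑ v, if (S.adjGraph T).connectedComponentMk v = K.1 then (s v : ℤ) • z v else 0
  map_add' x y := by
    ext K
    simp only [Pi.add_apply, smul_add, ← Finset.sum_add_distrib]
    exact Finset.sum_congr rfl fun v _ => by split_ifs <;> simp
  map_smul' r x := by
    ext K
    simp only [Pi.smul_apply, RingHom.id_apply, Finset.smul_sum]
    exact Finset.sum_congr rfl fun v _ => by
      split_ifs
      · exact smul_comm _ _ _
      · simp

open scoped Classical in
theorem componentSum_single [Fintype V] (T : Finset E) (s : V → ℤˣ) (v : V) (a : A)
    (K : S.BalancedComponent T) :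
    componentSum R A S T s (Pi.single v a) K =
      if (S.adjGraph T).connectedComponentMk v = K.1 then (s v : ℤ) • a else 0 := by
  simp only [componentSum, LinearMap.coe_mk, AddHom.coe_mk]
  rw [Finset.sum_eq_single v]
  · simp
  · intro w _ hw
    simp [hw]
  · simp

theorem componentSum_surjective [Fintype V] (T : Finset E) (s : V → ℤˣ) :
    Function.Surjective (componentSum R A S T s) := by
  classical
  intro g
  have : Fintype (S.BalancedComponent T) := Fintype.ofFinite _
  choose r hr using fun K : S.BalancedComponent T => K.1.exists_rep
  refine ⟨∑ K, Pi.single (r K) ((s (r K) : ℤ) • g K), ?_⟩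
  ext K
  rw [map_sum, Finset.sum_apply, Finset.sum_eq_single K]
  · rw [componentSum_single]
    have : (S.adjGraph T).connectedComponentMk (r K) = K.1 := hr K
    rw [if_pos this, smul_smul, ← Units.val_mul, Int.units_mul_self, Units.val_one, one_smul]
  · intro K' _ hK
    rw [componentSum_single]
    have : (S.adjGraph T).connectedComponentMk (r K') = K'.1 := hr K'
    rw [if_neg (fun h => hK (Subtype.ext (this.symm.trans h)))]
  · simp

/-- If `A` is divisible by two, the image of the boundary map consists of the node labels with
vanishing switched sum on each balanced component.  The classes, in the cokernel, of labels
concentrated at a node form a potential with values in linear maps from `A`, which determines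
them up to one linear map for each balanced component. -/
theorem range_boundary [Fintype V] (hA : ∀ a : A, ∃ b, b + b = a) (τ : S.Orientation)
    (T : Finset E) {s : V → ℤˣ}
    (hs : ∀ e ∈ T, ∀ v w σ, S.edge e = .ordinary v w σ →
      S.IsBalanced (S.componentEdges T ((S.adjGraph T).connectedComponentMk v)) →
      s v * s w = σ) :
    LinearMap.range (τ.boundary R A T) = LinearMap.ker (componentSum R A S T s) := by
  classical
  apply le_antisymm
  · rintro _ ⟨x, rfl⟩
    rw [LinearMap.mem_ker, τ.boundary_apply, map_sum]
    refine Finset.sum_eq_zero fun e _ => ?_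
    rw [τ.incidence_smul]
    funext K
    rcases (S.edge e.1).eq_cases with ⟨v, w, σ, h⟩ | ⟨v, h⟩ | h
    · obtain ⟨α, β, hαβ, harr⟩ := τ.ordinary_mul h
      simp only [harr, Multiset.insert_eq_cons, Multiset.map_cons, Multiset.map_singleton,
        Multiset.sum_cons, Multiset.sum_singleton, map_add, Pi.add_apply, componentSum_single,
        SimpleGraph.ConnectedComponent.sound (adjGraph_reachable e.2 h), Pi.zero_apply]
      split_ifs with hK
      · have hb := K.2
        rw [← hK, ← SimpleGraph.ConnectedComponent.sound (adjGraph_reachable e.2 h)] at hb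
        have h3 := hs e e.2 v w σ h hb
        rw [smul_smul, smul_smul, ← add_smul, ← Units.val_mul, ← Units.val_mul]
        have h4 : s v * α = -(s w * β) := by
          have : σ = -(α * β) := by rw [hαβ, neg_neg]
          rw [this] at h3
          calc s v * α = (s v * s w) * s w * α := by
                rw [mul_assoc (s v), Int.units_mul_self, mul_one]
            _ = -(s w * β) * (α * α) := by rw [h3, neg_mul, neg_mul, neg_mul]; congr 1; ac_rfl
            _ = _ := by rw [Int.units_mul_self, mul_one]
        rw [h4]
        simp
      · simp
    · obtain ⟨α, harr⟩ := τ.half_arrows h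
      simp only [harr, Multiset.map_singleton, Multiset.sum_singleton, componentSum_single,
        Pi.zero_apply]
      rw [if_neg]
      rintro hK
      have hb := K.2
      rw [← hK] at hb
      exact not_isHalf_of_isBalanced e.2 hb h
    · rw [τ.loose_arrows h]; simp
  · intro z hz
    rw [LinearMap.mem_ker] at hz
    set N := LinearMap.range (τ.boundary R A T) with hN
    let q : V → (A →ₗ[R] ((V → A) ⧸ N)) := fun v => N.mkQ ∘ₗ LinearMap.single R (fun _ => A) v
    have hq : τ.IsPotential T q := by
      intro e he
      ext a
      have h1 : N.mkQ (fun v => τ.incidence v e • a) = 0 := by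
        rw [Submodule.mkQ_apply, Submodule.Quotient.mk_eq_zero]
        refine ⟨Pi.single ⟨e, he⟩ a, ?_⟩
        rw [τ.boundary_apply, Finset.sum_eq_single ⟨e, he⟩]
        · simp
        · intro f _ hf
          ext v
          simp [hf]
        · simp
      rw [τ.incidence_smul, map_multiset_sum, Multiset.map_map] at h1
      have h2 : ∀ m : Multiset (V × ℤˣ), (m.map fun p => (p.2 : ℤ) • q p.1).sum a =
          (m.map (N.mkQ ∘ fun p => (Pi.single p.1 ((p.2 : ℤ) • a) : V → A))).sum := by
        intro m
        induction m using Multiset.induction_on with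
        | empty => simp
        | cons p m ih =>
          simp only [Multiset.map_cons, Multiset.sum_cons, LinearMap.add_apply, ih]
          congr 1
          simp only [q, LinearMap.smul_apply, LinearMap.comp_apply, LinearMap.coe_single,
            Function.comp]
          rw [← map_zsmul, ← Pi.single_smul]
      rw [h2, h1, LinearMap.zero_apply]
    have hB : ∀ b : A →ₗ[R] ((V → A) ⧸ N), b + b = 0 → b = 0 := by
      intro b hb
      ext a
      obtain ⟨a', rfl⟩ := hA a
      rw [map_add, ← LinearMap.add_apply, hb, LinearMap.zero_apply, LinearMap.zero_apply]
    have : Fintype (S.BalancedComponent T) := Fintype.ofFinite _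
    choose r hr using fun K : S.BalancedComponent T => K.1.exists_rep
    have hr' : ∀ K, (S.adjGraph T).connectedComponentMk (r K) = K.1 := hr
    have hz' : N.mkQ z = ∑ v, q v (z v) := by
      conv_lhs => rw [← Finset.univ_sum_single z]
      rw [map_sum]
      rfl
    have hzero : N.mkQ z = 0 := by
      calc N.mkQ z = ∑ v, ∑ K : S.BalancedComponent T,
            (if (S.adjGraph T).connectedComponentMk v = K.1 then
              ((s (r K) : ℤ) • q (r K)) ((s v : ℤ) • z v) else 0) := by
            rw [hz']
            refine Finset.sum_congr rfl fun v _ => ?_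
            by_cases hb : S.IsBalanced
                (S.componentEdges T ((S.adjGraph T).connectedComponentMk v))
            · rw [Finset.sum_eq_single ⟨_, hb⟩]
              · rw [if_pos rfl]
                have hrv := SimpleGraph.ConnectedComponent.exact
                  (hr' ⟨(S.adjGraph T).connectedComponentMk v, hb⟩)
                rw [← hq.smul_eq hs hrv.symm hb, LinearMap.smul_apply, map_zsmul, smul_smul,
                  ← Units.val_mul, Int.units_mul_self, Units.val_one, one_smul]
              · intro K _ hK
                rw [if_neg (fun h => hK (Subtype.ext h.symm))]
              · simp
            · have hq0 : q v = 0 := by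
                by_contra hne
                exact hb (hq.isBalanced hB hne)
              rw [hq0, LinearMap.zero_apply, Finset.sum_eq_zero]
              intro K _
              rw [if_neg]
              intro h
              exact hb (h ▸ K.2)
        _ = ∑ K : S.BalancedComponent T,
            ((s (r K) : ℤ) • q (r K)) (componentSum R A S T s z K) := by
            rw [Finset.sum_comm]
            refine Finset.sum_congr rfl fun K _ => ?_
            simp only [componentSum, LinearMap.coe_mk, AddHom.coe_mk]
            rw [map_sum]
            refine Finset.sum_congr rfl fun v _ => ?_
            split_ifs <;> simp
        _ = 0 := by simp [hz]
    rwa [Submodule.mkQ_apply, Submodule.Quotient.mk_eq_zero] at hzero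

end Boundary

end SignedGraph

/-! ### Regions of an arrangement of hyperplanes -/

open scoped Classical in
/-- **Zaslavsky's theorem** on the regions of an arrangement, for linear functionals `f e` on a
finite-dimensional real space `W`: the number of sign patterns on `F` which the functionals assume
without zeros is a sum over the subsets `U` of `F` of signs given by the codimension of the flat
`⋂ e ∈ U, ker (f e)` of `W`.  A functional `f a ≠ 0` added to `F` splits exactly those regions that
meet its kernel. -/
theorem card_signPatterns {ι M : Type*} [AddCommGroup M] [Module ℝ M] [FiniteDimensional ℝ M]
    (f : ι → M →ₗ[ℝ] ℝ) (F : Finset ι) (W : Submodule ℝ M) :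
    (∑ P ∈ F.powerset, if ∃ x ∈ W, ∀ e ∈ F, if e ∈ P then 0 < f e x else f e x < 0
      then 1 else 0 : ℤ) =
    ∑ U ∈ F.powerset, (-1) ^ (U.card + Module.finrank ℝ W +
      Module.finrank ℝ (W ⊓ ⨅ e ∈ U, LinearMap.ker (f e) : Submodule ℝ M)) := by
  induction F using Finset.induction_on generalizing W with
  | empty =>
    have : ∃ x, x ∈ W := ⟨0, W.zero_mem⟩
    have h2 : (W ⊓ ⨅ e ∈ (∅ : Finset ι), LinearMap.ker (f e)) = W := by simp
    rw [Finset.powerset_empty, Finset.sum_singleton, Finset.sum_singleton, h2, Finset.card_empty,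
      zero_add, Even.neg_one_pow ⟨_, rfl⟩]
    simp [this]
  | insert a F ha ih =>
    rw [Finset.sum_powerset_insert ha, Finset.sum_powerset_insert ha]
    have hinf : ∀ U : Finset ι, (⨅ e ∈ insert a U, LinearMap.ker (f e)) =
        LinearMap.ker (f a) ⊓ ⨅ e ∈ U, LinearMap.ker (f e) := fun U => Finset.iInf_insert a U _
    have hcard : ∀ U ∈ F.powerset, (insert a U).card = U.card + 1 := fun U hU =>
      Finset.card_insert_of_notMem fun h => ha (Finset.mem_powerset.1 hU h)
    by_cases hW : W ≤ LinearMap.ker (f a)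
    · -- no region has a sign at `a`, and the terms of `U` and `insert a U` cancel
      have h0 : ∀ x ∈ W, f a x = 0 := fun x hx => hW hx
      have hL : ∀ P : Finset ι, ¬ ∃ x ∈ W, ∀ e ∈ insert a F,
          if e ∈ P then 0 < f e x else f e x < 0 := by
        rintro P ⟨x, hx, h⟩
        have := h a (Finset.mem_insert_self _ _)
        rw [h0 x hx] at this
        split_ifs at this <;> exact lt_irrefl _ this
      simp only [hL, if_false, Finset.sum_const_zero, add_zero]
      rw [← Finset.sum_add_distrib, Finset.sum_eq_zero]
      intro U hU
      rw [hinf, ← inf_assoc, inf_eq_left.2 hW, hcard U hU]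
      ring
    · have hdim : Module.finrank ℝ W =
          Module.finrank ℝ (W ⊓ LinearMap.ker (f a) : Submodule ℝ M) + 1 := by
        have h1 := LinearMap.finrank_range_add_finrank_ker (f a ∘ₗ W.subtype)
        have h2 : LinearMap.range (f a ∘ₗ W.subtype) = ⊤ := by
          rw [LinearMap.range_eq_top]
          apply LinearMap.surjective
          intro h
          apply hW
          intro x hx
          exact LinearMap.congr_fun h ⟨x, hx⟩
        rw [h2, finrank_top, Module.finrank_self, LinearMap.ker_comp] at h1
        rw [← h1, add_comm, ← Submodule.map_comap_subtype,
          LinearEquiv.finrank_eq (Submodule.equivSubtypeMap W _)]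
      have hstep := congrArg₂ (· + ·) (ih W) (ih (W ⊓ LinearMap.ker (f a)))
      have hR : ∀ U ∈ F.powerset, ((-1 : ℤ)) ^ ((insert a U).card + Module.finrank ℝ W +
          Module.finrank ℝ (W ⊓ ⨅ e ∈ insert a U, LinearMap.ker (f e) : Submodule ℝ M)) =
          (-1) ^ (U.card + Module.finrank ℝ (W ⊓ LinearMap.ker (f a) : Submodule ℝ M) +
          Module.finrank ℝ
            (W ⊓ LinearMap.ker (f a) ⊓ ⨅ e ∈ U, LinearMap.ker (f e) : Submodule ℝ M)) := by
        intro U hU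
        rw [hinf, ← inf_assoc, hcard U hU, hdim]
        ring
      rw [Finset.sum_congr rfl hR, ← hstep, ← Finset.sum_add_distrib, ← Finset.sum_add_distrib]
      refine Finset.sum_congr rfl fun P hP => ?_
      have haP : a ∉ P := fun h => ha (Finset.mem_powerset.1 hP h)
      obtain ⟨w, hw, hwa⟩ : ∃ w ∈ W, 0 < f a w := by
        obtain ⟨w, hw, hwa⟩ := SetLike.not_le_iff_exists.1 hW
        rcases lt_or_gt_of_ne (show f a w ≠ 0 from hwa) with h | h
        · exact ⟨-w, W.neg_mem hw, by simpa using h⟩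
        · exact ⟨w, hw, h⟩
      -- the region of `W` with sign pattern `P` on `F`, which the hyperplane of `f a` may split
      let C : Set M := {x | x ∈ W ∧ ∀ e ∈ F, if e ∈ P then 0 < f e x else f e x < 0}
      have hminus : (∃ x ∈ W, ∀ e ∈ insert a F, if e ∈ P then 0 < f e x else f e x < 0) ↔
          ∃ x ∈ C, f a x < 0 := by
        constructor
        · rintro ⟨x, hx, h⟩
          refine ⟨x, ⟨hx, fun e he => h e (Finset.mem_insert_of_mem he)⟩, ?_⟩
          simpa [haP] using h a (Finset.mem_insert_self _ _)
        · rintro ⟨x, ⟨hx, h⟩, hxa⟩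
          refine ⟨x, hx, fun e he => ?_⟩
          rcases Finset.mem_insert.1 he with rfl | he
          · simpa [haP] using hxa
          · exact h e he
      have hplus : (∃ x ∈ W, ∀ e ∈ insert a F,
          if e ∈ insert a P then 0 < f e x else f e x < 0) ↔ ∃ x ∈ C, 0 < f a x := by
        have hne : ∀ e ∈ F, (e ∈ insert a P ↔ e ∈ P) := fun e he => by
          rw [Finset.mem_insert, or_iff_right]; rintro rfl; exact ha he
        constructor
        · rintro ⟨x, hx, h⟩
          refine ⟨x, ⟨hx, fun e he => ?_⟩, ?_⟩
          · have := h e (Finset.mem_insert_of_mem he)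
            simpa only [hne e he] using this
          simpa using h a (Finset.mem_insert_self _ _)
        · rintro ⟨x, ⟨hx, h⟩, hxa⟩
          refine ⟨x, hx, fun e he => ?_⟩
          rcases Finset.mem_insert.1 he with rfl | he
          · simpa using hxa
          · simpa only [hne e he] using h e he
      have hzero : (∃ x ∈ W ⊓ LinearMap.ker (f a), ∀ e ∈ F,
          if e ∈ P then 0 < f e x else f e x < 0) ↔ ∃ x ∈ C, f a x = 0 :=
        ⟨fun ⟨x, hx, h⟩ => ⟨x, ⟨hx.1, h⟩, hx.2⟩, fun ⟨x, hx, h⟩ => ⟨x, ⟨hx.1, h⟩, hx.2⟩⟩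
      have hall : (∃ x ∈ W, ∀ e ∈ F, if e ∈ P then 0 < f e x else f e x < 0) ↔ ∃ x, x ∈ C :=
        Iff.rfl
      rw [hminus, hplus, hzero, hall]
      -- the region is convex
      have hconv : ∀ x ∈ C, ∀ y ∈ C, ∀ s t : ℝ, 0 < s → 0 < t → s • x + t • y ∈ C := by
        intro x hx y hy s t hs ht
        refine ⟨W.add_mem (W.smul_mem _ hx.1) (W.smul_mem _ hy.1), fun e he => ?_⟩
        have h1 := hx.2 e he
        have h2 := hy.2 e he
        simp only [map_add, map_smul, smul_eq_mul]
        split_ifs at h1 h2 ⊢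
        · positivity
        · nlinarith [mul_pos hs (neg_pos.2 h1), mul_pos ht (neg_pos.2 h2)]
      -- the region is open
      have hopen : ∀ x ∈ C, ∃ δ : ℝ, 0 < δ ∧ ∀ t : ℝ, |t| ≤ δ → x + t • w ∈ C := by
        intro x hx
        have : ∀ᶠ t : ℝ in nhds 0, ∀ e ∈ F,
            if e ∈ P then 0 < f e (x + t • w) else f e (x + t • w) < 0 := by
          rw [Filter.eventually_all_finset]
          intro e he
          have hc : ContinuousAt (fun t : ℝ => f e (x + t • w)) 0 := by
            simp only [map_add, map_smul, smul_eq_mul]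
            fun_prop
          have h1 := hx.2 e he
          split_ifs at h1 ⊢
          · exact hc.eventually (lt_mem_nhds (by simpa using h1))
          · exact hc.eventually (gt_mem_nhds (by simpa using h1))
        obtain ⟨δ, hδ, h⟩ := Metric.eventually_nhds_iff.1 this
        refine ⟨δ / 2, by positivity, fun t ht => ⟨W.add_mem hx.1 (W.smul_mem _ hw), h ?_⟩⟩
        rw [Real.dist_eq, sub_zero]
        linarith
      have hz2 : (∃ x ∈ C, f a x = 0) ↔ (∃ x ∈ C, f a x < 0) ∧ ∃ x ∈ C, 0 < f a x := by
        constructor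
        · rintro ⟨x, hx, h0⟩
          obtain ⟨δ, hδ, h⟩ := hopen x hx
          refine ⟨⟨_, h (-δ) (by rw [abs_neg, abs_of_pos hδ]), ?_⟩,
            ⟨_, h δ (abs_of_pos hδ).le, ?_⟩⟩
          · simp only [map_add, map_smul, smul_eq_mul, h0]
            nlinarith
          · simp only [map_add, map_smul, smul_eq_mul, h0]
            nlinarith
        · rintro ⟨⟨x, hx, hx0⟩, y, hy, hy0⟩
          refine ⟨f a y • x + (-f a x) • y, hconv x hx y hy _ _ hy0 (neg_pos.2 hx0), ?_⟩
          simp only [map_add, map_smul, smul_eq_mul]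
          ring
      have ha2 : (∃ x, x ∈ C) ↔ (∃ x ∈ C, f a x < 0) ∨ ∃ x ∈ C, 0 < f a x := by
        constructor
        · rintro ⟨x, hx⟩
          rcases lt_trichotomy (f a x) 0 with h | h | h
          · exact Or.inl ⟨x, hx, h⟩
          · exact Or.inl (hz2.1 ⟨x, hx, h⟩).1
          · exact Or.inr ⟨x, hx, h⟩
        · rintro (⟨x, hx, -⟩ | ⟨x, hx, -⟩) <;> exact ⟨x, hx⟩
      rw [hz2, ha2]
      by_cases h1 : ∃ x ∈ C, f a x < 0 <;> by_cases h2 : ∃ x ∈ C, 0 < f a x <;> simp [h1, h2]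

/-! ### Rank and the spaces of flows -/

theorem LinearMap.card_eq_card_ker_mul_card_range {X Y : Type*} [AddCommGroup X] [AddCommGroup Y]
    (f : X →ₗ[ℤ] Y) :
    Nat.card X = Nat.card (LinearMap.ker f) * Nat.card (LinearMap.range f) := by
  rw [← Nat.card_congr f.quotKerEquivRange.toEquiv]
  exact Submodule.card_eq_card_quotient_mul_card _

theorem exists_add_self_eq_of_odd_card {A : Type*} [AddCommGroup A] [Finite A]
    (hA : Odd (Nat.card A)) (a : A) :
    ∃ b, b + b = a := by
  obtain ⟨m, hm⟩ := hA
  -- twice `m + 1` is one more than the order of `A`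
  refine ⟨(m + 1) • a, ?_⟩
  rw [← add_smul, show m + 1 + (m + 1) = Nat.card A + 1 by omega, add_smul, card_nsmul_eq_zero']
  simp

namespace SignedGraph

theorem nonempty_orientation {V E : Type*} (S : SignedGraph V E) : Nonempty S.Orientation := by
  refine ⟨fun e => Classical.choice ?_⟩
  cases S.edge e with
  | ordinary v w σ => exact ⟨⟨(1, -σ), one_mul _⟩⟩
  | half v => exact ⟨(1 : ℤˣ)⟩
  | loose => exact ⟨(1 : ℤˣ)⟩

section Rank

variable {V E : Type*} [Fintype V] {S : SignedGraph V E}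

theorem finrank_range_boundary (τ : S.Orientation) (T : Finset E) :
    Module.finrank ℝ (LinearMap.range (τ.boundary ℝ ℝ T)) + S.numBalanced T = Fintype.card V := by
  obtain ⟨s, hs⟩ := exists_switching S T
  have : Fintype (S.BalancedComponent T) := Fintype.ofFinite _
  have h1 := LinearMap.finrank_range_add_finrank_ker (componentSum ℝ ℝ S T s)
  rw [LinearMap.range_eq_top.2 (componentSum_surjective T s), finrank_top,
    Module.finrank_fintype_fun_eq_card, Module.finrank_fintype_fun_eq_card,
    ← range_boundary (fun a => ⟨a / 2, add_halves a⟩) τ T hs] at h1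
  rw [numBalanced, ← h1, Nat.card_eq_fintype_card, add_comm]

theorem numBalanced_le (S : SignedGraph V E) (T : Finset E) :
    S.numBalanced T ≤ Fintype.card V := by
  obtain ⟨τ⟩ := S.nonempty_orientation
  have := finrank_range_boundary τ T
  omega

theorem rank_eq_finrank (τ : S.Orientation) (T : Finset E) :
    S.rank T = Module.finrank ℝ (LinearMap.range (τ.boundary ℝ ℝ T)) := by
  have := finrank_range_boundary τ T
  rw [rank]
  omega

theorem rank_mono (S : SignedGraph V E) {T T' : Finset E} (h : T ⊆ T') : S.rank T ≤ S.rank T' := by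
  classical
  obtain ⟨τ⟩ := S.nonempty_orientation
  rw [rank_eq_finrank τ, rank_eq_finrank τ]
  apply Submodule.finrank_mono
  rintro _ ⟨x, rfl⟩
  refine ⟨fun e => if he : e.1 ∈ T then x ⟨e, he⟩ else 0, ?_⟩
  funext v
  simp only [Orientation.boundary, LinearMap.coe_mk, AddHom.coe_mk]
  rw [Finset.univ_eq_attach, Finset.univ_eq_attach,
    Finset.sum_attach T' (fun e => τ.incidence v e • (if he : e ∈ T then x ⟨e, he⟩ else 0)),
    ← Finset.sum_subset h (fun e _ he => by simp [he]), ← Finset.sum_attach T]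
  exact Finset.sum_congr rfl fun e _ => by simp

theorem rank_le_card (S : SignedGraph V E) (T : Finset E) : S.rank T ≤ T.card := by
  obtain ⟨τ⟩ := S.nonempty_orientation
  rw [rank_eq_finrank τ]
  refine (LinearMap.finrank_range_le _).trans ?_
  simp

theorem finrank_ker_boundary (τ : S.Orientation) (T : Finset E) :
    Module.finrank ℝ (LinearMap.ker (τ.boundary ℝ ℝ T)) = T.card - S.rank T := by
  have h := LinearMap.finrank_range_add_finrank_ker (τ.boundary ℝ ℝ T)
  rw [← rank_eq_finrank, Module.finrank_fintype_fun_eq_card, Fintype.card_coe] at h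
  omega

/-- For finite `A` of odd order, the orders of the image of the boundary map and of its cokernel
`A ^ b(T)` are known from `range_boundary`, and hence that of its kernel. -/
theorem card_ker_boundary (τ : S.Orientation) (T : Finset E) {A : Type*} [AddCommGroup A]
    [Finite A] (hA : Odd (Nat.card A)) :
    Nat.card (LinearMap.ker (τ.boundary ℤ A T)) = Nat.card A ^ (T.card - S.rank T) := by
  obtain ⟨s, hs⟩ := exists_switching S T
  have h1 := LinearMap.card_eq_card_ker_mul_card_range (τ.boundary ℤ A T)
  have h2 := LinearMap.card_eq_card_ker_mul_card_range (componentSum ℤ A S T s)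
  rw [range_boundary (exists_add_self_eq_of_odd_card hA) τ T hs] at h1
  rw [LinearMap.range_eq_top.2 (componentSum_surjective T s),
    Nat.card_congr Submodule.topEquiv.toEquiv] at h2
  rw [Nat.card_fun, Nat.card_fun] at h2
  rw [Nat.card_fun] at h1
  have h3 : Nat.card (S.BalancedComponent T) = S.numBalanced T := rfl
  have hpos : 0 < Nat.card A := Nat.card_pos
  have hle := S.numBalanced_le T
  have hle2 := S.rank_le_card T
  rw [h3, Nat.card_eq_fintype_card (α := V),
    show Fintype.card V = S.rank T + S.numBalanced T by rw [rank]; omega, pow_add] at h2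
  have h4 := Nat.eq_of_mul_eq_mul_right (pow_pos hpos _) h2
  rw [← h4, Nat.card_eq_fintype_card (α := T), Fintype.card_coe,
    show T.card = (T.card - S.rank T) + S.rank T by omega, pow_add] at h1
  simpa using (Nat.eq_of_mul_eq_mul_right (pow_pos hpos _) h1).symm

variable [Fintype E] (R A : Type*) [CommRing R] [AddCommGroup A] [Module R A]

/-- The flows with values in `A` that vanish outside the edge set `T`. -/
noncomputable def Orientation.flows (τ : S.Orientation) (T : Finset E) : Submodule R (E → A) where
  carrier := {x | τ.IsFlow x ∧ ∀ e ∉ T, x e = 0}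
  add_mem' := by
    rintro x y ⟨hx, hx'⟩ ⟨hy, hy'⟩
    refine ⟨fun v => ?_, fun e he => by simp [hx' e he, hy' e he]⟩
    simp only [Pi.add_apply, smul_add, Finset.sum_add_distrib, hx v, hy v, add_zero]
  zero_mem' := ⟨fun v => by simp, by simp⟩
  smul_mem' := by
    rintro r x ⟨hx, hx'⟩
    refine ⟨fun v => ?_, fun e he => by simp [hx' e he]⟩
    simp only [Pi.smul_apply, smul_comm _ r, ← Finset.smul_sum, hx v, smul_zero]

variable {A}

omit [Fintype V] in
theorem Orientation.boundary_restrict (τ : S.Orientation) {T : Finset E} {x : E → A}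
    (hx : ∀ e ∉ T, x e = 0) (v : V) :
    τ.boundary R A T (fun e => x e) v = ∑ e, τ.incidence v e • x e := by
  simp only [boundary, LinearMap.coe_mk, AddHom.coe_mk]
  rw [Finset.univ_eq_attach, Finset.sum_attach T (fun e => τ.incidence v e • x e)]
  exact Finset.sum_subset (Finset.subset_univ _) fun e _ he => by simp [hx e he]

variable (A)

open scoped Classical in
/-- Restriction to `T` identifies the flows supported in `T` with the kernel of the boundary map. -/
noncomputable def Orientation.flowsEquiv (τ : S.Orientation) (T : Finset E) :
    τ.flows R A T ≃ₗ[R] LinearMap.ker (τ.boundary R A T) where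
  toFun x := ⟨fun e => x.1 e, by
    rw [LinearMap.mem_ker]
    funext v
    rw [τ.boundary_restrict R x.2.2]
    exact x.2.1 v⟩
  map_add' x y := rfl
  map_smul' r x := rfl
  invFun x := ⟨fun e => if he : e ∈ T then x.1 ⟨e, he⟩ else 0, by
    refine ⟨fun v => ?_, fun e he => by simp [he]⟩
    rw [← τ.boundary_restrict R (T := T) (fun e he => by simp [he])]
    have : (fun e : T => if he : e.1 ∈ T then x.1 ⟨e, he⟩ else 0) = x.1 := by funext e; simp
    rw [this, LinearMap.mem_ker.1 x.2]
    rfl⟩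
  left_inv x := by
    ext e
    by_cases he : e ∈ T
    · simp [he]
    · simp [he, x.2.2 e he]
  right_inv x := by ext e; simp

variable {R A}

theorem finrank_flows (τ : S.Orientation) (T : Finset E) :
    Module.finrank ℝ (τ.flows ℝ ℝ T) = T.card - S.rank T := by
  rw [← finrank_ker_boundary τ T, (τ.flowsEquiv ℝ ℝ T).finrank_eq]

theorem card_flows (τ : S.Orientation) (T : Finset E) {A : Type*} [AddCommGroup A]
    [Finite A] (hA : Odd (Nat.card A)) :
    Nat.card (τ.flows ℤ A T) = Nat.card A ^ (T.card - S.rank T) := by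
  rw [← card_ker_boundary τ T hA, Nat.card_congr (τ.flowsEquiv ℤ A T).toEquiv]

/-- The bias matroid is represented over `ℝ` by the columns of the incidence matrix: a set is
dependent exactly when it supports a nonzero flow. -/
theorem rank_lt_card_iff (τ : S.Orientation) (T : Finset E) :
    S.rank T < T.card ↔ ∃ x ∈ τ.flows ℝ ℝ T, x ≠ 0 := by
  rw [← Nat.sub_pos_iff_lt, ← finrank_flows τ, Module.finrank_pos_iff_exists_ne_zero]
  simp

end Rank

end SignedGraph

/-! ### The flow polynomial and the Tutte polynomial -/

theorem Finset.card_eq_natCard_of_subtype {X : Type*} {p q : X → Prop}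
    (s : Finset {x // p x}) (h : ∀ x, x ∈ s ↔ q x.1) :
    s.card = Nat.card {x // p x ∧ q x} := by
  rw [← Nat.card_congr (Equiv.subtypeSubtypeEquivSubtypeInter p q), ← Nat.card_eq_finsetCard]
  exact Nat.card_congr (Equiv.subtypeEquivRight h)

namespace SignedGraph

section FlowPolynomial

open Polynomial

variable {V E : Type*} [Fintype V] [Fintype E] (S : SignedGraph V E)

open scoped Classical in
/-- The modular flow polynomial, by its subset expansion. -/
noncomputable def flowPolynomial : ℤ[X] :=
  ∑ T : Finset E, (-1) ^ Tᶜ.card * X ^ (T.card - S.rank T)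

/-- Nowhere-zero flows are counted by inclusion and exclusion over the sets of edges on which a
flow vanishes. -/
theorem isModularFlowPolynomial_flowPolynomial : S.IsModularFlowPolynomial S.flowPolynomial := by
  classical
  intro A _ _ hA τ
  have : Fintype A := Fintype.ofFinite A
  have : Fintype {x : E → A // τ.IsFlow x} := Fintype.ofFinite _
  let Z : E → Finset {x : E → A // τ.IsFlow x} := fun e => Finset.univ.filter fun x => x.1 e = 0
  have h := Finset.inclusion_exclusion_card_inf_compl Finset.univ Z
  rw [Finset.card_eq_natCard_of_subtype (q := fun x => ∀ e, x e ≠ 0) _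
    (fun x => by simp [Finset.mem_inf, Z])] at h
  rw [h, flowPolynomial, eval_finsetSum, Finset.powerset_univ]
  refine (Fintype.sum_equiv (Function.Involutive.toPerm _ compl_involutive) _ _ fun T => ?_).symm
  rw [Finset.card_eq_natCard_of_subtype (q := fun x => ∀ e ∉ T, x e = 0) _
    (fun x => by simp [Finset.mem_inf, Z])]
  have h1 := card_flows τ T hA
  change Nat.card {x : E → A // τ.IsFlow x ∧ ∀ e ∉ T, x e = 0} = _ at h1
  rw [h1]
  simp

theorem eval_flowPolynomial_neg_one :
    (S.cyclomatic.negOnePow : ℤ) * S.flowPolynomial.eval (-1) =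
      ∑ T : Finset E, (-1) ^ (S.rank Finset.univ + S.rank T) := by
  classical
  have h0 : S.cyclomatic = ((Fintype.card E - S.rank Finset.univ : ℕ) : ℤ) := by
    have h1 := S.rank_le_card Finset.univ
    have h2 := S.numBalanced_le Finset.univ
    rw [Finset.card_univ] at h1
    rw [cyclomatic, Nat.cast_sub h1, rank, Nat.cast_sub h2]
    ring
  rw [h0, flowPolynomial, eval_finsetSum, Finset.mul_sum]
  refine Finset.sum_congr rfl fun T _ => ?_
  have h1 := S.rank_le_card Finset.univ
  have h2 := S.rank_le_card T
  have h3 := Finset.card_add_card_compl T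
  rw [Finset.card_univ] at h1
  rw [Int.negOnePow_def, zpow_natCast]
  simp only [Units.val_pow_eq_pow_val, Units.val_neg, Units.val_one, eval_mul, eval_pow, eval_neg,
    eval_one, eval_X]
  rw [← pow_add, ← pow_add]
  refine neg_one_pow_congr ?_
  rw [Nat.even_iff, Nat.even_iff]
  omega

theorem eval_tuttePolynomial :
    MvPolynomial.eval ![0, 2] S.tuttePolynomial =
      ∑ T : Finset E, (-1) ^ (S.rank Finset.univ + S.rank T) := by
  rw [tuttePolynomial, map_sum, Finset.powerset_univ]
  refine Finset.sum_congr rfl fun T _ => ?_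
  have := S.rank_mono (Finset.subset_univ T)
  simp only [map_mul, map_pow, map_sub, map_one, MvPolynomial.eval_X, Matrix.cons_val_zero,
    Matrix.cons_val_one, zero_sub]
  norm_num
  refine neg_one_pow_congr ?_
  rw [Nat.even_iff, Nat.even_iff]
  omega

end FlowPolynomial

end SignedGraph

/-! ### Cycles and positive flows -/

namespace SignedGraph

section Cycles

variable {V E : Type*} {S : SignedGraph V E}

theorem Orientation.map_fst_arrows (τ : S.Orientation) (e : E) :
    ((S.edge e).arrows (τ e)).map Prod.fst = (S.edge e).ends := by
  rcases (S.edge e).eq_cases with ⟨v, w, σ, h⟩ | ⟨v, h⟩ | h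
  · obtain ⟨α, β, -, harr⟩ := τ.ordinary_mul h
    rw [harr, h]
    rfl
  · obtain ⟨α, harr⟩ := τ.half_arrows h
    rw [harr, h]
    rfl
  · rw [τ.loose_arrows h, h]
    rfl

theorem Orientation.card_arrows_le (τ : S.Orientation) (e : E) :
    ((S.edge e).arrows (τ e)).card ≤ 2 := by
  rcases (S.edge e).eq_cases with ⟨v, w, σ, h⟩ | ⟨v, h⟩ | h
  · obtain ⟨α, β, -, harr⟩ := τ.ordinary_mul h
    rw [harr]
    rfl
  · obtain ⟨α, harr⟩ := τ.half_arrows h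
    rw [harr]
    simp
  · rw [τ.loose_arrows h]
    simp

theorem Orientation.exists_arrow (τ : S.Orientation) {e : E} {v : V} (h : v ∈ (S.edge e).ends) :
    ∃ α : ℤˣ, (v, α) ∈ (S.edge e).arrows (τ e) := by
  rw [← τ.map_fst_arrows, Multiset.mem_map] at h
  obtain ⟨⟨_, α⟩, hp, rfl⟩ := h
  exact ⟨α, hp⟩

theorem Orientation.mem_ends_of_arrow (τ : S.Orientation) {e : E} {v : V} {α : ℤˣ}
    (h : (v, α) ∈ (S.edge e).arrows (τ e)) : v ∈ (S.edge e).ends := by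
  rw [← τ.map_fst_arrows]
  exact Multiset.mem_map_of_mem Prod.fst h

open scoped Classical in
theorem Orientation.mul_incidence (τ : S.Orientation) {e : E} {v : V} {α : ℤˣ}
    (h : (v, -α) ∉ (S.edge e).arrows (τ e)) :
    (α : ℤ) * τ.incidence v e = (S.edge e).ends.count v := by
  rw [← τ.map_fst_arrows, Multiset.count_map]
  unfold Orientation.incidence
  revert h
  induction (S.edge e).arrows (τ e) using Multiset.induction_on with
  | empty => simp
  | cons p m ih =>
    intro h
    rw [Multiset.mem_cons, not_or] at h
    have ih := ih h.2
    by_cases hp : p.1 = v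
    · have hpα : p.2 = α := by
        by_contra hne
        apply h.1
        ext
        · exact hp.symm
        · have := Int.units_ne_iff_eq_neg.1 hne
          simp [this]
      rw [Multiset.filter_cons_of_pos (p := fun p : V × ℤˣ => p.1 = v) _ hp,
        Multiset.filter_cons_of_pos (p := fun p : V × ℤˣ => v = p.1) _ hp.symm,
        Multiset.map_cons, Multiset.sum_cons, mul_add, ih, hpα, ← Units.val_mul,
        Int.units_mul_self]
      simp [add_comm]
    · rw [Multiset.filter_cons_of_neg (p := fun p : V × ℤˣ => p.1 = v) _ hp,
        Multiset.filter_cons_of_neg (p := fun p : V × ℤˣ => v = p.1) _ (Ne.symm hp), ih]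

variable [Fintype E]

/-- A nonnegative flow has no source and no sink on its support, as the terms of the balance
equation at a node would all have one sign. -/
theorem Orientation.IsFlow.exists_arrow (τ : S.Orientation) {x : E → ℝ} (hx : τ.IsFlow x)
    (h0 : ∀ e, 0 ≤ x e) {e : E} (he : x e ≠ 0) {v : V} (hv : v ∈ (S.edge e).ends) (α : ℤˣ) :
    ∃ f, x f ≠ 0 ∧ (v, α) ∈ (S.edge f).arrows (τ f) := by
  classical
  by_contra! hc
  have hinc : ∀ f, x f ≠ 0 →
      (((-α : ℤˣ) : ℤ) : ℝ) * ((τ.incidence v f : ℤ) : ℝ) = (S.edge f).ends.count v := by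
    intro f hf
    have := τ.mul_incidence (α := -α) (v := v) (e := f) (by simpa using hc f hf)
    exact_mod_cast this
  have h1 : ∑ f, ((S.edge f).ends.count v : ℝ) * x f = 0 := by
    have h2 := congrArg (fun r => (((-α : ℤˣ) : ℤ) : ℝ) * r) (hx v)
    simp only [mul_zero, Finset.mul_sum] at h2
    rw [← h2]
    refine Finset.sum_congr rfl fun f _ => ?_
    by_cases hf : x f = 0
    · simp [hf]
    · rw [← hinc f hf, zsmul_eq_mul, mul_assoc]
  rw [Finset.sum_eq_zero_iff_of_nonneg fun f _ => mul_nonneg (Nat.cast_nonneg _) (h0 f)] at h1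
  have h2 := h1 e (Finset.mem_univ _)
  rw [mul_eq_zero, Nat.cast_eq_zero, Multiset.count_eq_zero] at h2
  exact h2.elim (fun h => h hv) he

/-- Subtracting from a nonnegative flow `x` the largest admissible multiple of a flow `z`
shrinks the support. -/
theorem Orientation.exists_smaller_flow (τ : S.Orientation) {x z : E → ℝ} (hx : τ.IsFlow x)
    (h0 : ∀ e, 0 ≤ x e) (hz : τ.IsFlow z) (hzx : ∀ e, x e = 0 → z e = 0) {e : E} (he : 0 < x e)
    (hze : z e ≤ 0) (hpos : ∃ f, 0 < z f) :
    ∃ y : E → ℝ, τ.IsFlow y ∧ (∀ e, 0 ≤ y e) ∧ 0 < y e ∧ (∀ f, x f = 0 → y f = 0) ∧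
      ∃ f, x f ≠ 0 ∧ y f = 0 := by
  obtain ⟨f, hf, hmin⟩ := Finset.exists_min_image (Finset.univ.filter fun f => 0 < z f)
    (fun f => x f / z f) (by obtain ⟨f, hf⟩ := hpos; exact ⟨f, by simpa using hf⟩)
  simp only [Finset.mem_filter, Finset.mem_univ, true_and] at hf hmin
  -- `x f / z f` is the largest `t` for which `x - t z` is nonnegative
  have ht : 0 ≤ x f / z f := div_nonneg (h0 f) hf.le
  refine ⟨fun g => x g - x f / z f * z g, fun v => ?_, fun g => ?_, ?_, fun g hg => ?_,
    f, fun h => hf.ne' (hzx f h), ?_⟩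
  · have h1 := hx v
    have h2 := hz v
    simp only [zsmul_eq_mul] at h1 h2 ⊢
    simp only [mul_sub, Finset.sum_sub_distrib, h1, mul_left_comm _ (x f / z f), ← Finset.mul_sum,
      h2, mul_zero, sub_zero]
  · rcases le_or_gt (z g) 0 with hg | hg
    · nlinarith [h0 g, mul_nonneg ht (neg_nonneg.2 hg)]
    · have := hmin g hg
      rw [le_div_iff₀ hg] at this
      linarith
  · nlinarith [mul_nonneg ht (neg_nonneg.2 hze)]
  · simp [hg, hzx g hg]
  · simp only []
    rw [div_mul_cancel₀ _ hf.ne', sub_self]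

variable [Fintype V]

/-- Every edge with positive value in a nonnegative flow belongs to a cycle: a nonnegative flow
of minimal support that is positive there is supported by a circuit. -/
theorem Orientation.exists_isCycle_of_flow (τ : S.Orientation) {x : E → ℝ} (hx : τ.IsFlow x)
    (h0 : ∀ e, 0 ≤ x e) {e : E} (he : 0 < x e) : ∃ C, τ.IsCycle C ∧ e ∈ C := by
  classical
  induction hn : (Finset.univ.filter fun f => x f ≠ 0).card using Nat.strong_induction_on
    generalizing x with
  | _ n ih =>
  set C := Finset.univ.filter fun f => x f ≠ 0 with hC
  have hmem : ∀ f, f ∈ C ↔ x f ≠ 0 := by simp [hC]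
  by_cases hcirc : S.IsCircuit C
  · refine ⟨C, ⟨hcirc, ?_⟩, (hmem e).2 he.ne'⟩
    rintro v ⟨f, hf, hv⟩
    have key : ∀ α : ℤˣ, ∃ g ∈ C, (v, α) ∈ (S.edge g).arrows (τ g) := fun α => by
      obtain ⟨g, hg, h⟩ := Orientation.IsFlow.exists_arrow τ hx h0 ((hmem f).1 hf) hv α
      exact ⟨g, (hmem g).2 hg, h⟩
    exact ⟨key 1, key (-1)⟩
  · have hdep : S.rank C < C.card := by
      rw [rank_lt_card_iff τ]
      exact ⟨x, ⟨hx, fun f hf => by simpa [hmem] using hf⟩, fun h => he.ne' (congrFun h e)⟩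
    obtain ⟨T, hT, hTC, hne⟩ : ∃ T : Finset E, S.rank T < T.card ∧ T ⊆ C ∧ ¬ C ⊆ T := by
      by_contra! hc
      exact hcirc ⟨hdep, fun T hT hTC => hc T hT hTC⟩
    obtain ⟨z, ⟨hz, hzT⟩, hz0⟩ := (rank_lt_card_iff τ T).1 hT
    have hzx : ∀ f, x f = 0 → z f = 0 := fun f hf =>
      hzT f fun h => (hmem f).1 (hTC h) hf
    have hneg : τ.IsFlow (-z) := fun v => by simpa using hz v
    -- induction applies to a nonnegative flow whose support is smaller than that of `x`
    have hsmall : ∀ y : E → ℝ, τ.IsFlow y → (∀ e, 0 ≤ y e) → 0 < y e →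
        (∀ f, x f = 0 → y f = 0) → (∃ f, x f ≠ 0 ∧ y f = 0) → ∃ C, τ.IsCycle C ∧ e ∈ C := by
      rintro y hy hy0 hye hyx ⟨f, hfx, hfy⟩
      refine ih _ ?_ hy hy0 hye rfl
      rw [← hn]
      refine Finset.card_lt_card ⟨fun g hg => ?_, fun h => ?_⟩
      · simp only [Finset.mem_filter, Finset.mem_univ, true_and] at hg
        exact (hmem g).2 fun h => hg (hyx g h)
      · have := h ((hmem f).2 hfx)
        simp [hfy] at this
    have hred : ∀ z : E → ℝ, τ.IsFlow z → (∀ f, x f = 0 → z f = 0) → z e ≤ 0 → (∃ f, 0 < z f) →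
        ∃ C, τ.IsCycle C ∧ e ∈ C := by
      intro z hz hzx hze hpos
      obtain ⟨y, h1, h2, h3, h4, h5⟩ := τ.exists_smaller_flow hx h0 hz hzx he hze hpos
      exact hsmall y h1 h2 h3 h4 h5
    have hside : ∀ z : E → ℝ, τ.IsFlow z → (∀ f, x f = 0 → z f = 0) → (∀ f ∉ T, z f = 0) →
        z e < 0 → ∃ C, τ.IsCycle C ∧ e ∈ C := by
      intro z hz hzx hzT hze
      by_cases hpos : ∃ f, 0 < z f
      · exact hred z hz hzx hze.le hpos
      · push Not at hpos
        obtain ⟨f, hfC, hfT⟩ := Finset.not_subset.1 hne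
        refine hsmall (-z) (fun v => by simpa using hz v) (fun f => by simpa using hpos f)
          (by simpa using hze) (fun f hf => by simp [hzx f hf])
          ⟨f, (hmem f).1 hfC, by simp [hzT f hfT]⟩
    -- up to negation of `z`, either some coordinate is positive while `z e ≤ 0`, or `-z` is itself
    -- a nonnegative flow of smaller support that is positive at `e`
    rcases lt_trichotomy (z e) 0 with hze | hze | hze
    · exact hside z hz hzx hzT hze
    · obtain ⟨f, hf⟩ := Function.ne_iff.1 hz0
      rcases lt_or_gt_of_ne hf with hf | hf
      · exact hred (-z) hneg (fun f hf => by simp [hzx f hf]) (by simp [hze])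
          ⟨f, by simpa using hf⟩
      · exact hred z hz hzx hze.le ⟨f, hf⟩
    · exact hside (-z) hneg (fun f hf => by simp [hzx f hf]) (fun f hf => by simp [hzT f hf])
        (by simpa using hze)

/-- A cycle carries a nonnegative flow that is positive on it.  Otherwise some node labelling `y`
would have a positive scalar product with each column of the cycle, by separation; but at a node
of the cycle where `|y|` is largest there is an arrow against the sign of `y`, and the
scalar product with its column is at most zero. -/
theorem Orientation.IsCycle.exists_flow {τ : S.Orientation} {C : Finset E} (hC : τ.IsCycle C) :
    ∃ x : E → ℝ, τ.IsFlow x ∧ (∀ e, 0 ≤ x e) ∧ ∀ e ∈ C, 0 < x e := by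
  classical
  obtain ⟨hcirc, hnode⟩ := hC
  have hCne : C.Nonempty := Finset.card_pos.1 (lt_of_le_of_lt (Nat.zero_le _) hcirc.1)
  set K := τ.boundary ℝ ℝ C '' stdSimplex ℝ C with hK
  by_cases h0 : (0 : V → ℝ) ∈ K
  · obtain ⟨w, hw, hw0⟩ := h0
    obtain ⟨x, hx⟩ := (τ.flowsEquiv ℝ ℝ C).surjective ⟨w, hw0⟩
    have hxw : ∀ e (he : e ∈ C), x.1 e = w ⟨e, he⟩ := fun e he =>
      congrFun (congrArg Subtype.val hx) ⟨e, he⟩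
    have hnn : ∀ e, 0 ≤ x.1 e := by
      intro e
      by_cases he : e ∈ C
      · rw [hxw e he]; exact hw.1 _
      · rw [x.2.2 e he]
    refine ⟨x.1, x.2.1, hnn, fun e he => lt_of_le_of_ne (hnn e) ?_⟩
    have hdep : S.rank (C.filter fun e => x.1 e ≠ 0) < (C.filter fun e => x.1 e ≠ 0).card := by
      rw [rank_lt_card_iff τ]
      refine ⟨x.1, ⟨x.2.1, fun e he => ?_⟩, fun h => ?_⟩
      · by_contra hne
        exact he (Finset.mem_filter.2 ⟨by by_contra h; exact hne (x.2.2 e h), hne⟩)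
      · have h1 := hw.2
        rw [Finset.sum_eq_zero fun e _ => by rw [← hxw e.1 e.2, h]; rfl] at h1
        exact zero_ne_one h1
    have := hcirc.2 hdep (Finset.filter_subset _ _) he
    exact (Finset.mem_filter.1 this).2.symm
  · exfalso
    have hconv : Convex ℝ K := (convex_stdSimplex ℝ C).linear_image _
    have hclosed : IsClosed K :=
      ((isCompact_stdSimplex ℝ C).image (LinearMap.continuous_of_finiteDimensional _)).isClosed
    obtain ⟨f, u, hu, hfK⟩ := geometric_hahn_banach_point_closed hconv hclosed h0
    rw [map_zero] at hu
    set y : V → ℝ := fun v => f (Pi.single v 1) with hy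
    have hcol : ∀ e ∈ C,
        0 < (((S.edge e).arrows (τ e)).map fun p => ((p.2 : ℤ) : ℝ) * y p.1).sum := by
      intro e he
      have h1 := hu.trans (hfK _ ⟨_, single_mem_stdSimplex ℝ (⟨e, he⟩ : C), rfl⟩)
      have h2 : τ.boundary ℝ ℝ C (Pi.single ⟨e, he⟩ 1) = fun v => τ.incidence v e • (1 : ℝ) := by
        rw [τ.boundary_apply, Finset.sum_eq_single ⟨e, he⟩]
        · simp
        · intro f _ hf
          ext v
          simp [hf]
        · simp
      rw [h2, τ.incidence_smul, map_multiset_sum, Multiset.map_map] at h1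
      refine h1.trans_eq (congrArg Multiset.sum (Multiset.map_congr rfl fun p _ => ?_))
      simp only [Function.comp, hy]
      rw [Pi.single_smul, map_zsmul, zsmul_eq_mul]
    obtain ⟨e₀, he₀⟩ := hCne
    obtain ⟨v, hv, hmax⟩ := Finset.exists_max_image
      (Finset.univ.filter fun v => ∃ e ∈ C, v ∈ (S.edge e).ends) (fun v => |y v|) (by
        have hne : (S.edge e₀).arrows (τ e₀) ≠ 0 := by
          intro h
          have := hcol e₀ he₀
          simp [h] at this
        obtain ⟨p, hp⟩ := Multiset.exists_mem_of_ne_zero hne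
        exact ⟨p.1, by simpa using ⟨e₀, he₀, τ.mem_ends_of_arrow hp⟩⟩)
    simp only [Finset.mem_filter, Finset.mem_univ, true_and] at hv hmax
    obtain ⟨α, hα⟩ : ∃ α : ℤˣ, ((α : ℤ) : ℝ) * y v = -|y v| := by
      rcases abs_choice (y v) with h | h
      · exact ⟨-1, by rw [h]; simp⟩
      · exact ⟨1, by rw [h]; simp⟩
    obtain ⟨e, he, harr⟩ : ∃ e ∈ C, (v, α) ∈ (S.edge e).arrows (τ e) := by
      rcases Int.units_eq_one_or α with rfl | rfl
      exacts [(hnode v hv).1, (hnode v hv).2]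
    obtain ⟨m, hm⟩ := Multiset.exists_cons_of_mem harr
    have h1 := hcol e he
    have hcard := τ.card_arrows_le e
    rw [hm, Multiset.card_cons] at hcard
    rw [hm, Multiset.map_cons, Multiset.sum_cons, hα] at h1
    rcases Nat.eq_zero_or_pos m.card with hm0 | hm0
    · rw [Multiset.card_eq_zero.1 hm0, Multiset.map_zero, Multiset.sum_zero] at h1
      linarith [abs_nonneg (y v)]
    · obtain ⟨p, rfl⟩ := Multiset.card_eq_one.1 (show m.card = 1 by omega)
      have hp := hmax p.1 ⟨e, he, τ.mem_ends_of_arrow (α := p.2) (by rw [hm]; simp)⟩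
      rw [Multiset.map_singleton, Multiset.sum_singleton] at h1
      have h2 : ((p.2 : ℤ) : ℝ) * y p.1 ≤ |y p.1| := by
        rcases Int.units_eq_one_or p.2 with h | h <;> rw [h]
        · simpa using le_abs_self _
        · simpa using neg_le_abs _
      linarith

theorem Orientation.isTotallyCyclic_iff (τ : S.Orientation) :
    τ.IsTotallyCyclic ↔ ∃ x : E → ℝ, τ.IsFlow x ∧ ∀ e, 0 < x e := by
  constructor
  · intro h
    choose C hC heC using h
    choose x hx h0 hpos using fun e => (hC e).exists_flow
    refine ⟨∑ e, x e, fun v => ?_, fun e => ?_⟩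
    · simp only [Finset.sum_apply, Finset.smul_sum]
      rw [Finset.sum_comm]
      exact Finset.sum_eq_zero fun f _ => hx f v
    · rw [Finset.sum_apply]
      exact Finset.sum_pos' (fun f _ => h0 f e) ⟨e, Finset.mem_univ _, hpos e e (heC e)⟩
  · rintro ⟨x, hx, hpos⟩ e
    exact τ.exists_isCycle_of_flow hx (fun f => (hpos f).le) (hpos e)

end Cycles

end SignedGraph

/-! ### Counting totally cyclic orientations -/

/-- The orientation of an edge with all its arrows multiplied by `u`.  For a halfedge or a loose
edge it is the product of signs; the types are given because `Orientation` has to be unfolded. -/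
def SignedEdge.reorient {V : Type*} (u : ℤˣ) : (d : SignedEdge V) → d.Orientation → d.Orientation
  | .ordinary _ _ _, η => ⟨(u * η.1.1, u * η.1.2), by
      rw [mul_mul_mul_comm, Int.units_mul_self, one_mul, η.2]⟩
  | .half _, η => HMul.hMul (α := ℤˣ) (β := ℤˣ) (γ := ℤˣ) u η
  | .loose, η => HMul.hMul (α := ℤˣ) (β := ℤˣ) (γ := ℤˣ) u η

theorem SignedEdge.arrows_reorient {V : Type*} (u : ℤˣ) (d : SignedEdge V) (o : d.Orientation) :
    d.arrows (d.reorient u o) = (d.arrows o).map fun p => (p.1, u * p.2) := by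
  cases d <;> rfl

theorem SignedEdge.reorient_bijective {V : Type*} (d : SignedEdge V) (o : d.Orientation) :
    Function.Bijective fun u => d.reorient u o := by
  have hu : ∀ a : ℤˣ, Function.Bijective fun u => u * a := fun a =>
    (Equiv.mulRight a).bijective
  cases d with
  | ordinary v w s =>
    refine ⟨fun u u' h => ?_, fun o' => ?_⟩
    · exact (hu o.1.1).1 (congrArg (fun o => o.1.1) h)
    · obtain ⟨u, h⟩ := (hu o.1.1).2 o'.1.1
      refine ⟨u, Subtype.ext (Prod.ext h ?_)⟩
      have h1 := ((SignedEdge.ordinary v w s).reorient u o).2.trans o'.2.symm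
      rw [show ((SignedEdge.ordinary v w s).reorient u o).1.1 = o'.1.1 from h] at h1
      exact mul_left_cancel h1
  | half v => exact hu o
  | loose => exact hu o

namespace SignedGraph

variable {V E : Type*} {S : SignedGraph V E}

/-- The orientation that reverses `τ` on the edges outside `P`. -/
noncomputable def Orientation.reorient [DecidableEq E] (τ : S.Orientation) (P : Finset E) :
    S.Orientation :=
  fun e => (S.edge e).reorient (if e ∈ P then 1 else -1) (τ e)

theorem Orientation.reorient_bijective [Fintype E] [DecidableEq E] (τ : S.Orientation) :
    Function.Bijective τ.reorient := by
  have hsign : ∀ p q : Prop, ∀ [Decidable p] [Decidable q],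
      (if p then (1 : ℤˣ) else -1) = (if q then 1 else -1) → (p ↔ q) := by
    intro p q _ _ h
    by_cases hp : p <;> by_cases hq : q <;> simp_all
  constructor
  · intro P P' h
    ext e
    exact hsign _ _ (((S.edge e).reorient_bijective (τ e)).1 (congrFun h e))
  · intro τ'
    choose u hu using fun e => ((S.edge e).reorient_bijective (τ e)).2 (τ' e)
    refine ⟨Finset.univ.filter fun e => u e = 1, ?_⟩
    funext e
    rw [← hu e, reorient]
    congr 1
    rcases Int.units_eq_one_or (u e) with h | h <;> simp [h]

theorem Orientation.incidence_reorient [DecidableEq E] (τ : S.Orientation) (P : Finset E) (v : V)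
    (e : E) : (τ.reorient P).incidence v e = (if e ∈ P then 1 else -1) * τ.incidence v e := by
  unfold Orientation.incidence Orientation.reorient
  rw [SignedEdge.arrows_reorient, Multiset.filter_map, Multiset.map_map,
    ← Multiset.sum_map_mul_left]
  split_ifs <;> rfl

variable [Fintype V] [Fintype E]

/-- The totally cyclic orientations correspond to the sign patterns of the nowhere-zero real flows
of a fixed orientation. -/
theorem Orientation.isTotallyCyclic_reorient_iff [DecidableEq E] (τ : S.Orientation)
    (P : Finset E) :
    (τ.reorient P).IsTotallyCyclic ↔
      ∃ x ∈ τ.flows ℝ ℝ Finset.univ, ∀ e, if e ∈ P then 0 < x e else x e < 0 := by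
  rw [isTotallyCyclic_iff]
  have hflow : ∀ x : E → ℝ, (τ.reorient P).IsFlow x ↔
      τ.IsFlow fun e => if e ∈ P then x e else -x e := by
    intro x
    refine forall_congr' fun v => ?_
    have : ∀ e, (τ.reorient P).incidence v e • x e =
        τ.incidence v e • (if e ∈ P then x e else -x e) := by
      intro e
      rw [τ.incidence_reorient]
      split_ifs <;> simp
    simp only [this]
  constructor
  · rintro ⟨x, hx, hpos⟩
    refine ⟨_, ⟨(hflow x).1 hx, by simp⟩, fun e => ?_⟩
    split_ifs <;> simp [hpos e]
  · rintro ⟨x, ⟨hx, -⟩, hpos⟩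
    refine ⟨fun e => if e ∈ P then x e else -x e, (hflow _).2 ?_, fun e => ?_⟩
    · convert hx using 2 with e
      split_ifs <;> simp
    · have := hpos e
      simp only
      split_ifs at this ⊢
      · exact this
      · linarith

/-- The regions of the arrangement of coordinate hyperplanes in the space of real flows correspond
to the totally cyclic orientations, so that `card_signPatterns` counts them. -/
theorem card_isTotallyCyclic (S : SignedGraph V E) :
    (Nat.card {τ : S.Orientation // τ.IsTotallyCyclic} : ℤ) =
      ∑ T : Finset E, (-1) ^ (S.rank Finset.univ + S.rank T) := by
  classical
  obtain ⟨τ⟩ := S.nonempty_orientation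
  have h1 : Nat.card {τ : S.Orientation // τ.IsTotallyCyclic} =
      Nat.card {P : Finset E // ∃ x ∈ τ.flows ℝ ℝ Finset.univ,
        ∀ e ∈ Finset.univ, if e ∈ P then 0 < x e else x e < 0} := by
    refine (Nat.card_congr ?_).symm
    refine (Equiv.ofBijective _ τ.reorient_bijective).subtypeEquiv fun P => ?_
    simpa using (τ.isTotallyCyclic_reorient_iff P).symm
  have h2 := card_signPatterns (fun e => LinearMap.proj (R := ℝ) (φ := fun _ : E => ℝ) e)
    Finset.univ (τ.flows ℝ ℝ Finset.univ)
  rw [Finset.powerset_univ] at h2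
  rw [h1, Nat.card_eq_fintype_card, Fintype.card_subtype, Finset.card_filter]
  push_cast
  refine (Eq.trans ?_ h2).trans ?_
  · simp only [LinearMap.proj_apply]
    congr!
  · refine Fintype.sum_equiv (Function.Involutive.toPerm _ compl_involutive) _ _ fun U => ?_
    have h3 : τ.flows ℝ ℝ Finset.univ ⊓
        ⨅ e ∈ U, LinearMap.ker (LinearMap.proj (R := ℝ) (φ := fun _ : E => ℝ) e) =
        τ.flows ℝ ℝ Uᶜ := by
      ext x
      simp only [Submodule.mem_inf, Submodule.mem_iInf, LinearMap.mem_ker, LinearMap.proj_apply]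
      change (τ.IsFlow x ∧ _) ∧ _ ↔ τ.IsFlow x ∧ _
      simp
    rw [h3, finrank_flows, finrank_flows]
    simp only [Function.Involutive.coe_toPerm]
    have h4 := S.rank_le_card Finset.univ
    have h5 := S.rank_le_card Uᶜ
    have h6 := Finset.card_add_card_compl U
    rw [Finset.card_univ] at h4 ⊢
    refine neg_one_pow_congr ?_
    rw [Nat.even_iff, Nat.even_iff]
    omega

omit [Fintype V] in
open Polynomial in
/-- A modular flow polynomial is determined by its values at the orders of the groups `ZMod n`
with `n` odd. -/
theorem IsModularFlowPolynomial.unique {φ ψ : ℤ[X]} (hφ : S.IsModularFlowPolynomial φ)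
    (hψ : S.IsModularFlowPolynomial ψ) : φ = ψ := by
  obtain ⟨τ⟩ := S.nonempty_orientation
  refine eq_of_infinite_eval_eq φ ψ ?_
  refine (Set.infinite_range_of_injective (f := fun n : ℕ => ((2 * n + 1 : ℕ) : ℤ))
    fun m n h => by simpa using h).mono ?_
  rintro _ ⟨n, rfl⟩
  have hodd : Odd (Nat.card (ZMod (2 * n + 1))) := by rw [Nat.card_zmod]; exact ⟨n, rfl⟩
  have h := (hφ (ZMod (2 * n + 1)) hodd τ).symm.trans (hψ _ hodd τ)
  rwa [Nat.card_zmod] at h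

end SignedGraph

theorem corollaryC {V E : Type*} [Fintype V] [Fintype E] (S : SignedGraph V E) :
    (∃! φ : Polynomial ℤ, S.IsModularFlowPolynomial φ) ∧
    (∀ φ : Polynomial ℤ, S.IsModularFlowPolynomial φ →
      (Nat.card {τ : S.Orientation // τ.IsTotallyCyclic} : ℤ) =
        (S.cyclomatic.negOnePow : ℤ) * φ.eval (-1)) ∧
    (Nat.card {τ : S.Orientation // τ.IsTotallyCyclic} : ℤ) =
      MvPolynomial.eval ![0, 2] S.tuttePolynomial := by
  have h := S.isModularFlowPolynomial_flowPolynomial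
  refine ⟨⟨_, h, fun ψ hψ => hψ.unique h⟩, fun φ hφ => ?_, ?_⟩
  · rw [hφ.unique h, S.eval_flowPolynomial_neg_one, S.card_isTotallyCyclic]
  · rw [S.eval_tuttePolynomial, S.card_isTotallyCyclic]
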